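/- Let $\mathbb{K}$ be a field of characteristic $0$, let $n\ge 3$, and let $(q_{ij})_{1\le i,j\le n}$ be elements of $\mathbb{K}^*$ with $q_{ii}=1$ and $q_{ji}=q_{ij}^{-1}$ such that the $q_{ij}$ with $i<j$ are algebraically independent over $\mathbb{Q}$. Let $R=\mathbb{K}\langle x_1,\dots,x_n\rangle/(x_ix_j-q_{ij}x_jx_i)$ be the coordinate algebra of quantum affine $n$-space, graded by $\mathbb{Z}^n$ with $\deg x_i=e_i$, and let $\beta:\mathbb{Z}^n\times\mathbb{Z}^n\to\mathbb{K}^*$ be the natural bicharacter, $\beta(e_i,e_j)=q_{ij}$. For $a\in\mathbb{Z}^n$ let $\sigma_a$ be the linear map on $R$ with $\sigma_a(r)=\beta(a,d)r$ for $r$ homogeneous of degree $d$; let $\lambda_r,\rho_r$ denote left and right multiplication by $r$. For a linear map $\varphi:R\to R$, $a\in\mathbb{Z}^n$ and $r\in R$ put $[\varphi,r]_a=\varphi\lambda_r-\lambda_{\sigma_a(r)}\varphi$. Regard $\mathrm{End}_{\mathbb{K}}(R)$ as an $R$-bimodule via $r\varphi s=\lambda_r\varphi\lambda_s$. Put $D_q^{-1}(R)=0$,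 and for $m\ge 0$ let $D_q^m(R)$ be the $R$-subbimodule generated by all homogeneous linear maps $\varphi:R\to R$ (of any degree in $\mathbb{Z}^n$) for which there is $a\in\mathbb{Z}^n$ with $[\varphi,r]_a\in D_q^{m-1}(R)$ for all $r\in R$. The algebra of quantum differential operators is $D_q(R)=\bigcup_{m\ge0}D_q^m(R)$, filtered by the $D_q^m(R)$. Let $\delta_i$ be the linear map on $R$ with $\delta_i(rs)=\delta_i(r)\sigma_{e_i}(s)+r\delta_i(s)$ for all $r,s\in R$, $\delta_i(x_i)=1$ and $\delta_i(x_j)=0$ for $j\ne i$. Let $\Delta$ be the subalgebra of $D_q(R)$ generated by $\rho_{x_1},\dots,\rho_{x_n},\delta_1,\dots,\delta_n$, with the filtration $\Delta_m=\mathrm{span}_{\mathbb{K}}\{\rho_{x_1}^{i_1}\cdots\rho_{x_n}^{i_n}\delta_1^{j_1}\cdots\delta_n^{j_n} : i_1,\dots,i_n,j_1,\dots,j_n\ge0,\ j_1+\dots+j_n\le m\}$. The group $\mathbb{Z}^n$ acts on $\Delta$ by algebra automorphisms with $\gamma\cdot\rho_{x_i}=\beta(\gamma,e_i)\rho_{x_i}$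 and $\gamma\cdot\delta_i=\beta(\gamma,e_i)^{-1}\delta_i$. Let $\Delta\#\mathbb{Z}^n$ be the skew group algebra: the free left $\Delta$-module on $\mathbb{Z}^n$ with multiplication $(\varphi\gamma)(\psi\eta)=\varphi(\gamma\cdot\psi)(\gamma+\eta)$. It is filtered by $(\Delta\#\mathbb{Z}^n)_m=\Delta_m\#\mathbb{Z}^n$, the elements all of whose coefficients lie in $\Delta_m$. Then the map $f:\Delta\#\mathbb{Z}^n\to D_q(R)$, $f(\varphi\gamma)=\varphi\sigma_\gamma$ for $\varphi\in\Delta$, $\gamma\in\mathbb{Z}^n$, is an isomorphism of filtered algebras: $f$ is an isomorphism of $\mathbb{K}$-algebras and $f((\Delta\#\mathbb{Z}^n)_m)=D_q^m(R)$ for every $m\ge 0$. -/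

import Mathlib

noncomputable section

namespace QDiff

/-! ### Quantum differential operators on a graded algebra -/

/-- A bicharacter `Γ × Γ → K*` on an additive abelian group `Γ`. -/
structure Bicharacter (Γ K : Type*) [AddCommGroup Γ] [Field K] where
  /-- the underlying function -/
  toFun : Γ → Γ → Kˣ
  map_add_left : ∀ a b c, toFun (a + b) c = toFun a c * toFun b c
  map_add_right : ∀ a b c, toFun a (b + c) = toFun a b * toFun a c

section General

variable {K Γ R : Type*} [Field K] [AddCommGroup Γ] [DecidableEq Γ] [Ring R] [Algebra K R]
variable (𝒜 : Γ → Submodule K R) [GradedAlgebra 𝒜] (β : Bicharacter Γ K)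

/-- The grading operator `σ_a`: the linear map with `σ_a r = β(a, d) r` for `r` homogeneous of
degree `d`. -/
def sigma (a : Γ) : Module.End K R :=
  (DirectSum.toModule K Γ R fun d => ((β.toFun a d : Kˣ) : K) • (𝒜 d).subtype) ∘ₗ
    (DirectSum.decomposeLinearEquiv 𝒜).toLinearMap

/-- A linear map `φ : R → R` is homogeneous of degree `d` if it maps `R_e` to `R_{d+e}` for all
`e`. -/
def IsHomogeneousOfDegree (φ : Module.End K R) (d : Γ) : Prop :=
  ∀ e, ∀ r ∈ 𝒜 e, φ r ∈ 𝒜 (d + e)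

/-- Left multiplication `λ_r`. -/
def lam (r : R) : Module.End K R := LinearMap.mulLeft K r

/-- Right multiplication `ρ_r`. -/
def rho (r : R) : Module.End K R := LinearMap.mulRight K r

/-- The twisted commutator `[φ, r]_a = φ r - σ_a(r) φ`, for the `R`-bimodule structure on the
linear maps `R → R` given by `r φ s = λ_r φ λ_s`. -/
def qcomm (a : Γ) (φ : Module.End K R) (r : R) : Module.End K R :=
  φ * lam r - lam (sigma 𝒜 β a r) * φ

/-- The homogeneous maps `φ` for which there is `a ∈ Γ` with `[φ, r]_a ∈ S` for all `r`. -/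
def stepGens (S : Submodule K (Module.End K R)) : Set (Module.End K R) :=
  {φ | (∃ d, IsHomogeneousOfDegree 𝒜 φ d) ∧ ∃ a, ∀ r, qcomm 𝒜 β a φ r ∈ S}

/-- The `R`-subbimodule of `End_K(R)` generated by a set of maps. -/
def bimoduleSpan (S : Set (Module.End K R)) : Submodule K (Module.End K R) :=
  Submodule.span K {φ | ∃ r s : R, ∃ ψ ∈ S, φ = lam r * ψ * lam s}

/-- The `R`-bimodule `D_q^i(R)` of quantum differential operators of order at most `i`:
`D_q^0(R)` is generated by the homogeneous `φ` with `[φ, r]_a = 0` for some `a` and all `r`, and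
`D_q^{i+1}(R)` by the homogeneous `φ` with `[φ, r]_a ∈ D_q^i(R)` for some `a` and all `r`. -/
def DqOrder : ℕ → Submodule K (Module.End K R)
  | 0 => bimoduleSpan (stepGens 𝒜 β ⊥)
  | i + 1 => bimoduleSpan (stepGens 𝒜 β (DqOrder i))

theorem sigma_of_mem (a : Γ) {d : Γ} {r : R} (h : r ∈ 𝒜 d) :
    sigma 𝒜 β a r = ((β.toFun a d : Kˣ) : K) • r := by
  simp only [sigma, LinearMap.comp_apply, LinearEquiv.coe_coe,
    DirectSum.decomposeLinearEquiv_apply]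
  rw [DirectSum.decompose_of_mem 𝒜 h]
  erw [DirectSum.toModule_lof]
  simp

theorem ext_homogeneous {φ ψ : Module.End K R} (h : ∀ d, ∀ r ∈ 𝒜 d, φ r = ψ r) : φ = ψ := by
  ext r
  induction r using DirectSum.Decomposition.inductionOn 𝒜 with
  | zero => simp
  | homogeneous m => exact h _ _ m.2
  | add m m' h₁ h₂ => simp [h₁, h₂]

theorem sigma_mul (a b : Γ) : sigma 𝒜 β a * sigma 𝒜 β b = sigma 𝒜 β (a + b) := by
  refine ext_homogeneous 𝒜 fun d r hr => ?_
  rw [Module.End.mul_apply, sigma_of_mem 𝒜 β b hr, map_smul, sigma_of_mem 𝒜 β a hr,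
    sigma_of_mem 𝒜 β _ hr, β.map_add_left, smul_smul, Units.val_mul, mul_comm]

theorem toFun_zero_left (c : Γ) : β.toFun 0 c = 1 := by
  have h := β.map_add_left 0 0 c
  rw [add_zero] at h
  exact mul_eq_left.mp h.symm

theorem toFun_zero_right (c : Γ) : β.toFun c 0 = 1 := by
  have h := β.map_add_right c 0 0
  rw [add_zero] at h
  exact mul_eq_left.mp h.symm

theorem toFun_neg_left (a c : Γ) : β.toFun (-a) c = (β.toFun a c)⁻¹ := by
  have h := β.map_add_left (-a) a c
  rw [neg_add_cancel, toFun_zero_left] at h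
  exact eq_inv_of_mul_eq_one_left h.symm

theorem toFun_neg_right (a c : Γ) : β.toFun a (-c) = (β.toFun a c)⁻¹ := by
  have h := β.map_add_right a (-c) c
  rw [neg_add_cancel, toFun_zero_right] at h
  exact eq_inv_of_mul_eq_one_left h.symm

theorem sigma_zero : sigma 𝒜 β 0 = 1 := by
  refine ext_homogeneous 𝒜 fun d r hr => ?_
  rw [sigma_of_mem 𝒜 β _ hr, toFun_zero_left]
  simp

theorem sigma_mul_sigma_neg (a : Γ) : sigma 𝒜 β a * sigma 𝒜 β (-a) = 1 := by
  rw [sigma_mul, add_neg_cancel, sigma_zero]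

theorem sigma_neg_mul_sigma (a : Γ) : sigma 𝒜 β (-a) * sigma 𝒜 β a = 1 := by
  rw [sigma_mul, neg_add_cancel, sigma_zero]

theorem lam_mul (r s : R) : (lam (r * s) : Module.End K R) = lam r * lam s := by
  ext t; simp [lam]

theorem lam_one : (lam (1 : R) : Module.End K R) = 1 := by
  ext t; simp [lam]

theorem subset_bimoduleSpan {S : Set (Module.End K R)} {φ : Module.End K R} (h : φ ∈ S) :
    φ ∈ bimoduleSpan S :=
  Submodule.subset_span ⟨1, 1, φ, h, by simp [lam_one]⟩

theorem lam_mul_mem {S : Set (Module.End K R)} {φ : Module.End K R} (h : φ ∈ bimoduleSpan S)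
    (r : R) : lam r * φ ∈ bimoduleSpan S := by
  refine Submodule.span_induction (p := fun φ _ => lam r * φ ∈ bimoduleSpan S) ?_ ?_ ?_ ?_ h
  · rintro _ ⟨s, t, ψ, hψ, rfl⟩
    exact Submodule.subset_span ⟨r * s, t, ψ, hψ, by simp only [lam_mul, mul_assoc]⟩
  · simp
  · intro x y _ _ hx hy
    rw [mul_add]; exact add_mem hx hy
  · intro c x _ hx
    rw [mul_smul_comm]; exact Submodule.smul_mem _ _ hx

theorem mul_lam_mem {S : Set (Module.End K R)} {φ : Module.End K R} (h : φ ∈ bimoduleSpan S)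
    (r : R) : φ * lam r ∈ bimoduleSpan S := by
  refine Submodule.span_induction (p := fun φ _ => φ * lam r ∈ bimoduleSpan S) ?_ ?_ ?_ ?_ h
  · rintro _ ⟨s, t, ψ, hψ, rfl⟩
    exact Submodule.subset_span ⟨s, t * r, ψ, hψ, by simp only [lam_mul, mul_assoc]⟩
  · simp
  · intro x y _ _ hx hy
    rw [add_mul]; exact add_mem hx hy
  · intro c x _ hx
    rw [smul_mul_assoc]; exact Submodule.smul_mem _ _ hx

theorem bimoduleSpan_mono {S T : Set (Module.End K R)} (h : S ⊆ T) :
    bimoduleSpan S ≤ bimoduleSpan T := by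
  refine Submodule.span_mono ?_
  rintro _ ⟨r, s, ψ, hψ, rfl⟩
  exact ⟨r, s, ψ, h hψ, rfl⟩

theorem stepGens_mono {S T : Submodule K (Module.End K R)} (h : S ≤ T) :
    stepGens 𝒜 β S ⊆ stepGens 𝒜 β T := by
  rintro φ ⟨hd, a, ha⟩
  exact ⟨hd, a, fun r => h (ha r)⟩

/-- The submodules `0, D_q^0(R), D_q^1(R), …`. -/
def DqBelow : ℕ → Submodule K (Module.End K R)
  | 0 => ⊥
  | i + 1 => DqOrder 𝒜 β i

theorem DqBelow_succ (i : ℕ) :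
    DqBelow 𝒜 β (i + 1) = bimoduleSpan (stepGens 𝒜 β (DqBelow 𝒜 β i)) := by
  cases i <;> rfl

theorem DqBelow_le_succ (i : ℕ) : DqBelow 𝒜 β i ≤ DqBelow 𝒜 β (i + 1) := by
  induction i with
  | zero => exact bot_le
  | succ i ih =>
    rw [DqBelow_succ, DqBelow_succ 𝒜 β (i + 1)]
    exact bimoduleSpan_mono (stepGens_mono 𝒜 β ih)

theorem DqOrder_mono : Monotone (DqOrder 𝒜 β) :=
  monotone_nat_of_le_succ fun i => DqBelow_le_succ 𝒜 β (i + 1)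

theorem mul_homogeneous {φ ψ : Module.End K R} {d e : Γ} (hφ : IsHomogeneousOfDegree 𝒜 φ d)
    (hψ : IsHomogeneousOfDegree 𝒜 ψ e) : IsHomogeneousOfDegree 𝒜 (φ * ψ) (d + e) := by
  intro c r hr
  rw [add_assoc]
  exact hφ _ _ (hψ _ _ hr)

theorem qcomm_mul (a b : Γ) (φ ψ : Module.End K R) (r : R) :
    qcomm 𝒜 β (a + b) (φ * ψ) r =
      φ * qcomm 𝒜 β b ψ r + qcomm 𝒜 β a φ (sigma 𝒜 β b r) * ψ := by
  have : sigma 𝒜 β (a + b) r = sigma 𝒜 β a (sigma 𝒜 β b r) := by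
    rw [← sigma_mul]; rfl
  simp only [qcomm, this, mul_sub, sub_mul, mul_assoc, sub_add_sub_cancel]

/-- With the shift `DqBelow (i + 1) = D_q^i`, this contains `D_q^i D_q^j ⊆ D_q^{i+j}`. -/
theorem DqBelow_mul_aux (N : ℕ) : ∀ i j, i + j = N → ∀ φ ∈ DqBelow 𝒜 β (i + 1),
    ∀ ψ ∈ DqBelow 𝒜 β (j + 1), φ * ψ ∈ DqBelow 𝒜 β (N + 1) := by
  induction N using Nat.strong_induction_on with
  | _ N ih =>
  intro i j hN
  have low₁ : ∀ φ ∈ DqBelow 𝒜 β i, ∀ ψ ∈ DqBelow 𝒜 β (j + 1), φ * ψ ∈ DqBelow 𝒜 β N := by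
    intro φ hφ ψ hψ
    cases i with
    | zero =>
      have : φ = 0 := by simpa [DqBelow] using hφ
      simp [this]
    | succ i =>
      obtain ⟨M, rfl⟩ : ∃ M, N = M + 1 := ⟨i + j, by omega⟩
      exact ih M (by omega) i j (by omega) φ hφ ψ hψ
  have low₂ : ∀ φ ∈ DqBelow 𝒜 β (i + 1), ∀ ψ ∈ DqBelow 𝒜 β j, φ * ψ ∈ DqBelow 𝒜 β N := by
    intro φ hφ ψ hψ
    cases j with
    | zero =>
      have : ψ = 0 := by simpa [DqBelow] using hψ
      simp [this]
    | succ j =>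
      obtain ⟨M, rfl⟩ : ∃ M, N = M + 1 := ⟨i + j, by omega⟩
      exact ih M (by omega) i j (by omega) φ hφ ψ hψ
  have gens : ∀ φ ∈ stepGens 𝒜 β (DqBelow 𝒜 β i), ∀ ψ ∈ stepGens 𝒜 β (DqBelow 𝒜 β j), ∀ s : R,
      φ * lam s * ψ ∈ DqBelow 𝒜 β (N + 1) := by
    intro φ hφ ψ hψ s
    have hφ' : φ ∈ DqBelow 𝒜 β (i + 1) := by
      rw [DqBelow_succ]; exact subset_bimoduleSpan hφ
    have hψ' : ψ ∈ DqBelow 𝒜 β (j + 1) := by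
      rw [DqBelow_succ]; exact subset_bimoduleSpan hψ
    obtain ⟨⟨d, hd⟩, a, ha⟩ := hφ
    obtain ⟨⟨e, he⟩, b, hb⟩ := hψ
    have key : φ * ψ ∈ DqBelow 𝒜 β (N + 1) := by
      rw [DqBelow_succ]
      refine subset_bimoduleSpan ⟨⟨d + e, mul_homogeneous 𝒜 hd he⟩, a + b, fun r => ?_⟩
      rw [qcomm_mul]
      exact add_mem (low₂ _ hφ' _ (hb r)) (low₁ _ (ha _) _ hψ')
    have e₁ : φ * lam s * ψ = qcomm 𝒜 β a φ s * ψ + lam (sigma 𝒜 β a s) * (φ * ψ) := by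
      simp only [qcomm, sub_mul, mul_assoc, sub_add_cancel]
    rw [e₁]
    refine add_mem (DqBelow_le_succ 𝒜 β N (low₁ _ (ha s) _ hψ')) ?_
    rw [DqBelow_succ] at key ⊢
    exact lam_mul_mem key _
  intro φ hφ ψ hψ
  rw [DqBelow_succ] at hφ
  refine Submodule.span_induction (p := fun φ _ => φ * ψ ∈ DqBelow 𝒜 β (N + 1)) ?_ ?_ ?_ ?_ hφ
  · rintro _ ⟨r, s, φ', hφ', rfl⟩
    rw [DqBelow_succ] at hψ
    refine Submodule.span_induction
      (p := fun ψ _ => lam r * φ' * lam s * ψ ∈ DqBelow 𝒜 β (N + 1)) ?_ ?_ ?_ ?_ hψ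
    · rintro _ ⟨r', s', ψ', hψ', rfl⟩
      have h := gens φ' hφ' ψ' hψ' (s * r')
      rw [DqBelow_succ] at h ⊢
      have := mul_lam_mem (lam_mul_mem h r) s'
      rw [lam_mul] at this
      simpa only [mul_assoc] using this
    · simp
    · intro x y _ _ hx hy
      rw [mul_add]; exact add_mem hx hy
    · intro c x _ hx
      rw [mul_smul_comm]; exact Submodule.smul_mem _ _ hx
  · simp
  · intro x y _ _ hx hy
    rw [add_mul]; exact add_mem hx hy
  · intro c x _ hx
    rw [smul_mul_assoc]; exact Submodule.smul_mem _ _ hx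

theorem DqOrder_mul {i j : ℕ} {φ ψ : Module.End K R} (hφ : φ ∈ DqOrder 𝒜 β i)
    (hψ : ψ ∈ DqOrder 𝒜 β j) : φ * ψ ∈ DqOrder 𝒜 β (i + j) :=
  DqBelow_mul_aux 𝒜 β (i + j) i j rfl φ hφ ψ hψ

theorem one_mem_DqOrder_zero : (1 : Module.End K R) ∈ DqOrder 𝒜 β 0 := by
  refine subset_bimoduleSpan ⟨⟨0, fun e r hr => by simpa using hr⟩, 0, fun r => ?_⟩
  simp [qcomm, sigma_zero]

/-- The filtered algebra `D_q(R) = ⋃ i, D_q^i(R)` of quantum differential operators on `R`. -/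
def Dq : Subalgebra K (Module.End K R) where
  carrier := ⋃ i, (DqOrder 𝒜 β i : Set (Module.End K R))
  mul_mem' := by
    intro φ ψ hφ hψ
    obtain ⟨i, hi⟩ := Set.mem_iUnion.mp hφ
    obtain ⟨j, hj⟩ := Set.mem_iUnion.mp hψ
    exact Set.mem_iUnion.mpr ⟨i + j, DqOrder_mul 𝒜 β hi hj⟩
  add_mem' := by
    intro φ ψ hφ hψ
    obtain ⟨i, hi⟩ := Set.mem_iUnion.mp hφ
    obtain ⟨j, hj⟩ := Set.mem_iUnion.mp hψ
    exact Set.mem_iUnion.mpr ⟨max i j, add_mem (DqOrder_mono 𝒜 β (le_max_left i j) hi)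
      (DqOrder_mono 𝒜 β (le_max_right i j) hj)⟩
  algebraMap_mem' := by
    intro c
    refine Set.mem_iUnion.mpr ⟨0, ?_⟩
    rw [Algebra.algebraMap_eq_smul_one]
    exact Submodule.smul_mem _ c (one_mem_DqOrder_zero 𝒜 β)

theorem conj_of_homogeneous {φ : Module.End K R} {d : Γ} (hφ : IsHomogeneousOfDegree 𝒜 φ d)
    (a : Γ) : sigma 𝒜 β a * φ * sigma 𝒜 β (-a) = ((β.toFun a d : Kˣ) : K) • φ := by
  refine ext_homogeneous 𝒜 fun e r hr => ?_
  simp only [Module.End.mul_apply, LinearMap.smul_apply]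
  rw [sigma_of_mem 𝒜 β _ hr, map_smul, map_smul, sigma_of_mem 𝒜 β _ (hφ e r hr), smul_smul,
    β.map_add_right, toFun_neg_left, ← Units.val_mul]
  congr 2
  rw [mul_comm, mul_assoc, mul_inv_cancel, mul_one]

theorem rho_homogeneous {s : R} {d : Γ} (hs : s ∈ 𝒜 d) :
    IsHomogeneousOfDegree 𝒜 (rho s : Module.End K R) d := by
  intro e r hr
  rw [add_comm]
  exact SetLike.mul_mem_graded hr hs

theorem sigma_map_mul (a : Γ) (r s : R) :
    sigma 𝒜 β a (r * s) = sigma 𝒜 β a r * sigma 𝒜 β a s := by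
  induction r using DirectSum.Decomposition.inductionOn 𝒜 with
  | zero => simp
  | add m m' h₁ h₂ => simp [add_mul, h₁, h₂]
  | homogeneous m =>
    induction s using DirectSum.Decomposition.inductionOn 𝒜 with
    | zero => simp
    | add m m' h₁ h₂ => simp [mul_add, h₁, h₂]
    | homogeneous m' =>
      rw [sigma_of_mem 𝒜 β a (SetLike.mul_mem_graded m.2 m'.2), sigma_of_mem 𝒜 β a m.2,
        sigma_of_mem 𝒜 β a m'.2, β.map_add_right, smul_mul_smul_comm, Units.val_mul]

end General

/-! ### Quantum affine space -/

/-- Parameters of quantum affine `n`-space: a multiplicatively antisymmetric `n × n` matrix of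
nonzero scalars. -/
structure QMatrix (K : Type*) [Field K] (n : ℕ) where
  /-- the parameters `q_{ij}` -/
  q : Fin n → Fin n → Kˣ
  q_self : ∀ i, q i i = 1
  q_swap : ∀ i j, q j i = (q i j)⁻¹

section QuantumSpace

variable {K : Type*} [Field K] {n : ℕ} (Q : QMatrix K n)

/-- The relations `x_i x_j = q_{ij} x_j x_i`. -/
inductive Rel : FreeAlgebra K (Fin n) → FreeAlgebra K (Fin n) → Prop
  | comm (i j : Fin n) : Rel (FreeAlgebra.ι K i * FreeAlgebra.ι K j)
      (((Q.q i j : Kˣ) : K) • (FreeAlgebra.ι K j * FreeAlgebra.ι K i))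

/-- The coordinate algebra `K⟨x_1, …, x_n⟩ / (x_i x_j - q_{ij} x_j x_i)` of quantum affine
`n`-space. -/
def QSpace : Type _ := RingQuot (Rel Q)

instance : Ring (QSpace Q) := inferInstanceAs (Ring (RingQuot (Rel Q)))

instance : Algebra K (QSpace Q) := inferInstanceAs (Algebra K (RingQuot (Rel Q)))

/-- The quotient map from the free algebra. -/
def QSpace.mk : FreeAlgebra K (Fin n) →ₐ[K] QSpace Q := RingQuot.mkAlgHom K (Rel Q)

/-- The generators `x_i`. -/
def QSpace.x (i : Fin n) : QSpace Q := QSpace.mk Q (FreeAlgebra.ι K i)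

theorem QSpace.x_mul_x (i j : Fin n) :
    QSpace.x Q i * QSpace.x Q j = ((Q.q i j : Kˣ) : K) • (QSpace.x Q j * QSpace.x Q i) := by
  have h : QSpace.mk Q _ = QSpace.mk Q _ := RingQuot.mkAlgHom_rel K (Rel.comm (Q := Q) i j)
  simpa only [QSpace.x, map_mul, map_smul] using h

/-- The universal property of `QSpace Q`. -/
def QSpace.lift {B : Type*} [Ring B] [Algebra K B] (y : Fin n → B)
    (hy : ∀ i j, y i * y j = ((Q.q i j : Kˣ) : K) • (y j * y i)) : QSpace Q →ₐ[K] B :=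
  RingQuot.liftAlgHom K ⟨FreeAlgebra.lift K y, by
    rintro _ _ ⟨i, j⟩
    simpa using hy i j⟩

theorem QSpace.lift_x {B : Type*} [Ring B] [Algebra K B] (y : Fin n → B)
    (hy : ∀ i j, y i * y j = ((Q.q i j : Kˣ) : K) • (y j * y i)) (i : Fin n) :
    QSpace.lift Q y hy (QSpace.x Q i) = y i := by
  refine (RingQuot.liftAlgHom_mkAlgHom_apply K (FreeAlgebra.lift K y) _ _).trans ?_
  simp

theorem QSpace.induction {p : QSpace Q → Prop} (halg : ∀ c : K, p (algebraMap K _ c))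
    (hx : ∀ i, p (QSpace.x Q i)) (hmul : ∀ r s, p r → p s → p (r * s))
    (hadd : ∀ r s, p r → p s → p (r + s)) (r : QSpace Q) : p r := by
  obtain ⟨a, rfl⟩ : ∃ a, QSpace.mk Q a = r := RingQuot.mkAlgHom_surjective K (Rel Q) r
  induction a with
  | grade0 c => rw [AlgHom.commutes]; exact halg c
  | grade1 i => exact hx i
  | mul a b ha hb => rw [map_mul]; exact hmul _ _ ha hb
  | add a b ha hb => rw [map_add]; exact hadd _ _ ha hb

theorem QSpace.algHom_ext {B : Type*} [Ring B] [Algebra K B] {f g : QSpace Q →ₐ[K] B}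
    (h : ∀ i, f (QSpace.x Q i) = g (QSpace.x Q i)) : f = g := by
  ext r
  induction r using QSpace.induction with
  | halg c => simp
  | hx i => exact h i
  | hmul r s hr hs => simp [hr, hs]
  | hadd r s hr hs => simp [hr, hs]

/-- The standard basis vector `e_i` of `ℤ^n`. -/
def stdVec (i : Fin n) : Fin n → ℤ := Pi.single i 1

/-- The homogeneous component of degree `d ∈ ℤ^n` of `QSpace Q`, where `deg x_i = e_i`: the span
of the words in the generators of total degree `d`. -/
def grading (d : Fin n → ℤ) : Submodule K (QSpace Q) :=
  Submodule.span K {w | ∃ l : List (Fin n), (l.map stdVec).sum = d ∧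
    w = (l.map (QSpace.x Q)).prod}

theorem word_mem_grading (l : List (Fin n)) :
    (l.map (QSpace.x Q)).prod ∈ grading Q (l.map stdVec).sum :=
  Submodule.subset_span ⟨l, rfl, rfl⟩

theorem x_mem_grading (i : Fin n) : QSpace.x Q i ∈ grading Q (stdVec i) := by
  simpa using word_mem_grading Q [i]

instance grading_gradedMonoid : SetLike.GradedMonoid (grading Q) where
  one_mem := by simpa using word_mem_grading Q []
  mul_mem := by
    intro d e r s hr hs
    have h : r * s ∈ grading Q d * grading Q e := Submodule.mul_mem_mul hr hs
    rw [grading, grading, Submodule.span_mul_span] at h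
    refine Submodule.span_mono ?_ h
    rintro _ ⟨_, ⟨l, rfl, rfl⟩, _, ⟨l', rfl, rfl⟩, rfl⟩
    exact ⟨l ++ l', by simp, by simp⟩

/-- The decomposition of `QSpace Q` into its homogeneous components, as an algebra map. -/
def gradingMap : QSpace Q →ₐ[K] DirectSum (Fin n → ℤ) fun d => grading Q d :=
  QSpace.lift Q (fun i => DirectSum.of (fun d => grading Q d) (stdVec i)
    ⟨QSpace.x Q i, x_mem_grading Q i⟩) (by
      intro i j
      rw [DirectSum.of_mul_of, DirectSum.of_mul_of, ← DirectSum.lof_eq_of K, ← DirectSum.lof_eq_of K, ← map_smul,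
        DirectSum.lof_eq_of, DirectSum.lof_eq_of]
      exact DirectSum.of_eq_of_gradedMonoid_eq
        (Sigma.subtype_ext (add_comm _ _) (QSpace.x_mul_x Q i j)))

instance : GradedAlgebra (grading Q) :=
  GradedAlgebra.ofAlgHom _ (gradingMap Q)
    (QSpace.algHom_ext Q fun i => by simp [gradingMap, QSpace.lift_x])
    (by
      rintro d ⟨r, hr⟩
      refine Submodule.span_induction (p := fun r hr => gradingMap Q r =
        DirectSum.of (fun d => grading Q d) d ⟨r, hr⟩) ?_ ?_ ?_ ?_ hr
      · rintro _ ⟨l, rfl, rfl⟩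
        clear hr r
        induction l with
        | nil =>
          simp only [List.map_nil, List.prod_nil, map_one]
          rfl
        | cons i l ih =>
          simp only [List.map_cons, List.prod_cons, map_mul]
          rw [ih, gradingMap, QSpace.lift_x, DirectSum.of_mul_of]
          exact DirectSum.of_eq_of_gradedMonoid_eq (Sigma.subtype_ext (by rfl) rfl)
      · rw [map_zero]; exact (map_zero _).symm
      · intro x y hx hy h₁ h₂
        rw [map_add, h₁, h₂, ← map_add]; rfl
      · intro c x hx h
        rw [map_smul, h, ← DirectSum.lof_eq_of K, ← map_smul]; rfl)

/-- The natural bicharacter on `ℤ^n`: `β(e_i, e_j) = q_{ij}`. -/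
def natBichar : Bicharacter (Fin n → ℤ) K where
  toFun a b := ∏ i, ∏ j, Q.q i j ^ (a i * b j)
  map_add_left a b c := by simp [add_mul, zpow_add, Finset.prod_mul_distrib]
  map_add_right a b c := by simp [mul_add, zpow_add, Finset.prod_mul_distrib]

theorem natBichar_stdVec (i j : Fin n) :
    (natBichar Q).toFun (stdVec i) (stdVec j) = Q.q i j := by
  simp only [natBichar, stdVec]
  rw [Finset.prod_eq_single i, Finset.prod_eq_single j]
  · simp
  · intro b _ hb; simp [hb]
  · simp
  · intro b _ hb; simp [hb]
  · simp

/-- The operator `σ_a`, `a ∈ ℤ^n`, on quantum affine space. -/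
abbrev sig (a : Fin n → ℤ) : Module.End K (QSpace Q) := sigma (grading Q) (natBichar Q) a

/-- The algebra map `r ↦ (r, δ_i(r); 0, σ_{e_i}(r))` into upper triangular matrices, encoding
the right skew `σ_{e_i}`-derivation `δ_i`. -/
def deltaMat (i : Fin n) : QSpace Q →ₐ[K] Matrix (Fin 2) (Fin 2) (QSpace Q) :=
  QSpace.lift Q (fun j => !![QSpace.x Q j, if j = i then 1 else 0;
    0, ((Q.q i j : Kˣ) : K) • QSpace.x Q j]) (by
      intro j k
      have hs : ∀ a b, ((Q.q b a : Kˣ) : K) * ((Q.q a b : Kˣ) : K) = 1 := fun a b => by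
        rw [← Units.val_mul, Q.q_swap a b]; simp
      have h := QSpace.x_mul_x Q j k
      ext a b
      fin_cases a <;> fin_cases b
      · by_cases hj : j = i <;> by_cases hk : k = i <;> simp [hj, hk] <;>
          exact QSpace.x_mul_x Q _ _
      · by_cases hj : j = i
        · by_cases hk : k = i
          · subst hj; subst hk; simp [Q.q_self]
          · subst hj; simp [hk]
        · by_cases hk : k = i
          · subst hk; simp [hj, smul_smul, hs]
          · simp [hj, hk]
      · simp
      · simp [h, smul_smul]
        congr 1; ring)

/-- The skew derivation `δ_i`: the right skew `σ_{e_i}`-derivation of quantum affine space with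
`δ_i(x_i) = 1` and `δ_i(x_j) = 0` for `j ≠ i`; see `delta_mul`, `delta_x`, `delta_unique`. -/
def delta (i : Fin n) : Module.End K (QSpace Q) :=
  Matrix.entryLinearMap K (QSpace Q) 0 1 ∘ₗ (deltaMat Q i).toLinearMap

theorem deltaMat_entries (i : Fin n) (r : QSpace Q) :
    deltaMat Q i r 0 0 = r ∧ deltaMat Q i r 1 0 = 0 ∧
      deltaMat Q i r 1 1 = sig Q (stdVec i) r := by
  induction r using QSpace.induction with
  | halg c =>
    have h1 : (1 : QSpace Q) ∈ grading Q 0 := SetLike.GradedOne.one_mem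
    rw [AlgHom.commutes]
    refine ⟨by simp [Matrix.algebraMap_matrix_apply], by simp [Matrix.algebraMap_matrix_apply], ?_⟩
    rw [Algebra.algebraMap_eq_smul_one (A := QSpace Q), map_smul, sigma_of_mem _ _ _ h1,
      toFun_zero_right]
    simp [Matrix.algebraMap_matrix_apply, Algebra.algebraMap_eq_smul_one]
  | hx j =>
    rw [deltaMat, QSpace.lift_x, sigma_of_mem _ _ _ (x_mem_grading Q j), natBichar_stdVec]
    simp
  | hmul r s hr hs =>
    rw [map_mul, sigma_map_mul]
    simp [Matrix.mul_apply, hr, hs]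
  | hadd r s hr hs =>
    rw [map_add, map_add]
    simp [hr, hs]

theorem delta_mul (i : Fin n) (r s : QSpace Q) :
    delta Q i (r * s) = delta Q i r * sig Q (stdVec i) s + r * delta Q i s := by
  have h := deltaMat_entries Q i
  simp only [delta, LinearMap.comp_apply, AlgHom.toLinearMap_apply, map_mul,
    Matrix.entryLinearMap_apply, Matrix.mul_apply, Fin.sum_univ_two, (h r).1, (h s).2.2]
  rw [add_comm]

theorem delta_x (i j : Fin n) : delta Q i (QSpace.x Q j) = if j = i then 1 else 0 := by
  simp [delta, deltaMat, QSpace.lift_x]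

theorem delta_one (i : Fin n) : delta Q i 1 = 0 := by
  simp [delta]

theorem delta_unique (i : Fin n) (φ : Module.End K (QSpace Q))
    (hmul : ∀ r s, φ (r * s) = φ r * sig Q (stdVec i) s + r * φ s)
    (hx : ∀ j, φ (QSpace.x Q j) = if j = i then 1 else 0) : φ = delta Q i := by
  have h1 : φ 1 = 0 := by
    have h := hmul 1 1
    have hs : sig Q (stdVec i) 1 = 1 := by
      rw [sigma_of_mem _ _ _ (SetLike.GradedOne.one_mem : (1 : QSpace Q) ∈ grading Q 0),
        toFun_zero_right]
      simp
    rw [hs] at h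
    simpa using h
  ext r
  induction r using QSpace.induction with
  | halg c => rw [Algebra.algebraMap_eq_smul_one, map_smul, map_smul, h1, delta_one]
  | hx j => rw [hx, delta_x]
  | hmul r s hr hs => rw [hmul, delta_mul, hr, hs]
  | hadd r s hr hs => rw [map_add, map_add, hr, hs]

theorem delta_homogeneous (i : Fin n) :
    IsHomogeneousOfDegree (grading Q) (delta Q i) (-stdVec i) := by
  intro e r hr
  refine Submodule.span_induction (p := fun r _ => delta Q i r ∈ grading Q (-stdVec i + e))
    ?_ ?_ ?_ ?_ hr
  · rintro _ ⟨l, rfl, rfl⟩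
    clear hr r
    induction l with
    | nil => simp [delta_one]
    | cons j l ih =>
      simp only [List.map_cons, List.prod_cons, List.sum_cons]
      rw [delta_mul, delta_x]
      refine add_mem ?_ ?_
      · split_ifs with h
        · subst h
          rw [one_mul, sigma_of_mem _ _ _ (word_mem_grading Q l), neg_add_cancel_left]
          exact Submodule.smul_mem _ _ (word_mem_grading Q l)
        · simp
      · have := SetLike.mul_mem_graded (x_mem_grading Q j) ih
        rwa [add_left_comm] at this
  · simp
  · intro x y _ _ hx hy
    rw [map_add]; exact add_mem hx hy
  · intro c x _ hx
    rw [map_smul]; exact Submodule.smul_mem _ _ hx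

/-! ### The algebra `Δ` and the skew group algebra `Δ # ℤ^n` -/

/-- The operator `ρ_{x_i}`. -/
def rhoX (i : Fin n) : Module.End K (QSpace Q) := rho (QSpace.x Q i)

/-- The quantized Weyl algebra `Δ`, generated by the operators `ρ_{x_i}` and `δ_i`. -/
def Delta : Subalgebra K (Module.End K (QSpace Q)) :=
  Algebra.adjoin K (Set.range (rhoX Q) ∪ Set.range (delta Q))

theorem rhoX_mem (i : Fin n) : rhoX Q i ∈ Delta Q :=
  Algebra.subset_adjoin (Or.inl ⟨i, rfl⟩)

theorem delta_mem (i : Fin n) : delta Q i ∈ Delta Q :=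
  Algebra.subset_adjoin (Or.inr ⟨i, rfl⟩)

theorem conj_rhoX (a : Fin n → ℤ) (i : Fin n) :
    sig Q a * rhoX Q i * sig Q (-a) =
      (((natBichar Q).toFun a (stdVec i) : Kˣ) : K) • rhoX Q i :=
  conj_of_homogeneous _ _ (rho_homogeneous _ (x_mem_grading Q i)) a

theorem conj_delta (a : Fin n → ℤ) (i : Fin n) :
    sig Q a * delta Q i * sig Q (-a) =
      ((((natBichar Q).toFun a (stdVec i))⁻¹ : Kˣ) : K) • delta Q i := by
  rw [conj_of_homogeneous _ _ (delta_homogeneous Q i) a, toFun_neg_right]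

theorem conj_mul (a : Fin n → ℤ) (φ ψ : Module.End K (QSpace Q)) :
    sig Q a * (φ * ψ) * sig Q (-a) =
      (sig Q a * φ * sig Q (-a)) * (sig Q a * ψ * sig Q (-a)) := by
  have h : sig Q (-a) * sig Q a = 1 := sigma_neg_mul_sigma _ _ a
  calc sig Q a * (φ * ψ) * sig Q (-a)
      = sig Q a * φ * 1 * ψ * sig Q (-a) := by noncomm_ring
    _ = _ := by rw [← h]; noncomm_ring

theorem conj_mem (a : Fin n → ℤ) {φ : Module.End K (QSpace Q)} (hφ : φ ∈ Delta Q) :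
    sig Q a * φ * sig Q (-a) ∈ Delta Q := by
  refine Algebra.adjoin_induction (p := fun φ _ => sig Q a * φ * sig Q (-a) ∈ Delta Q)
    ?_ ?_ ?_ ?_ hφ
  · rintro _ (⟨i, rfl⟩ | ⟨i, rfl⟩)
    · rw [conj_rhoX]; exact Subalgebra.smul_mem _ (rhoX_mem Q i) _
    · rw [conj_delta]; exact Subalgebra.smul_mem _ (delta_mem Q i) _
  · intro c
    rw [← Algebra.commutes, mul_assoc, sigma_mul_sigma_neg, mul_one]
    exact Subalgebra.algebraMap_mem _ c
  · intro x y _ _ hx hy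
    rw [mul_add, add_mul]; exact add_mem hx hy
  · intro x y _ _ hx hy
    rw [conj_mul]; exact mul_mem hx hy

/-- The action of `ℤ^n` on `Δ` by algebra automorphisms, `γ • φ = σ_γ φ σ_γ⁻¹`. By `smul_rhoX` and
`smul_delta` it is the action with `γ • ρ_{x_i} = β(γ, e_i) ρ_{x_i}` and
`γ • δ_i = β(γ, e_i)⁻¹ δ_i`. -/
instance : MulSemiringAction (Multiplicative (Fin n → ℤ)) (Delta Q) where
  smul g φ := ⟨sig Q g.toAdd * φ.1 * sig Q (-g.toAdd), conj_mem Q _ φ.2⟩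
  one_smul φ := Subtype.ext <| by
    change sig Q 0 * φ.1 * sig Q (-0) = φ.1
    simp only [sig]
    rw [neg_zero, sigma_zero, one_mul, mul_one]
  mul_smul g h φ := Subtype.ext <| by
    change sig Q (g.toAdd + h.toAdd) * φ.1 * sig Q (-(g.toAdd + h.toAdd)) =
      sig Q g.toAdd * (sig Q h.toAdd * φ.1 * sig Q (-h.toAdd)) * sig Q (-g.toAdd)
    simp only [sig]
    rw [← sigma_mul, neg_add, add_comm (-g.toAdd), ← sigma_mul]
    simp only [mul_assoc]
  smul_zero g := Subtype.ext <| by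
    change sig Q g.toAdd * 0 * sig Q (-g.toAdd) = 0
    simp
  smul_add g φ ψ := Subtype.ext <| by
    change sig Q g.toAdd * (φ.1 + ψ.1) * sig Q (-g.toAdd) =
      sig Q g.toAdd * φ.1 * sig Q (-g.toAdd) + sig Q g.toAdd * ψ.1 * sig Q (-g.toAdd)
    rw [mul_add, add_mul]
  smul_one g := Subtype.ext <| by
    change sig Q g.toAdd * 1 * sig Q (-g.toAdd) = 1
    rw [mul_one, sigma_mul_sigma_neg]
  smul_mul g φ ψ := Subtype.ext (conj_mul Q g.toAdd φ.1 ψ.1)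

instance : SMulCommClass (Multiplicative (Fin n → ℤ)) K (Delta Q) where
  smul_comm g c φ := Subtype.ext <| by
    change sig Q g.toAdd * (c • φ.1) * sig Q (-g.toAdd) =
      c • (sig Q g.toAdd * φ.1 * sig Q (-g.toAdd))
    rw [mul_smul_comm, smul_mul_assoc]

theorem smul_rhoX (a : Fin n → ℤ) (i : Fin n) :
    Multiplicative.ofAdd a • (⟨rhoX Q i, rhoX_mem Q i⟩ : Delta Q) =
      (((natBichar Q).toFun a (stdVec i) : Kˣ) : K) • ⟨rhoX Q i, rhoX_mem Q i⟩ :=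
  Subtype.ext (conj_rhoX Q a i)

theorem smul_delta (a : Fin n → ℤ) (i : Fin n) :
    Multiplicative.ofAdd a • (⟨delta Q i, delta_mem Q i⟩ : Delta Q) =
      ((((natBichar Q).toFun a (stdVec i))⁻¹ : Kˣ) : K) • ⟨delta Q i, delta_mem Q i⟩ :=
  Subtype.ext (conj_delta Q a i)

/-- The skew group algebra `Δ # ℤ^n`: the free left `Δ`-module on `ℤ^n` with
`(φ γ)(ψ η) = φ (γ • ψ) (γ + η)`. The element `φ γ` is `SkewMonoidAlgebra.single γ φ`. -/
abbrev SkewDelta : Type _ := SkewMonoidAlgebra (Delta Q) (Multiplicative (Fin n → ℤ))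

/-- `ρ_I = ρ_{x_1}^{i_1} ⋯ ρ_{x_n}^{i_n}`. -/
def rhoPow (I : Fin n → ℕ) : Module.End K (QSpace Q) :=
  (List.ofFn fun i => rhoX Q i ^ I i).prod

/-- `δ_J = δ_1^{j_1} ⋯ δ_n^{j_n}`. -/
def deltaPow (J : Fin n → ℕ) : Module.End K (QSpace Q) :=
  (List.ofFn fun i => delta Q i ^ J i).prod

/-- The filtration of `Δ`: `Δ_m` is the span of the `ρ_I δ_J` with `j_1 + ⋯ + j_n ≤ m`. -/
def DeltaFil (m : ℕ) : Submodule K (Delta Q) :=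
  Submodule.comap (Delta Q).val.toLinearMap
    (Submodule.span K {φ | ∃ I J : Fin n → ℕ, ∑ i, J i ≤ m ∧ φ = rhoPow Q I * deltaPow Q J})

/-- The filtration `(Δ # ℤ^n)_m = Δ_m # ℤ^n`: all coefficients lie in `Δ_m`. -/
def SkewDeltaFil (m : ℕ) : Submodule K (SkewDelta Q) where
  carrier := {u | ∀ g, u.coeff g ∈ DeltaFil Q m}
  add_mem' := by
    intro u v hu hv g
    rw [SkewMonoidAlgebra.coeff_add]
    exact add_mem (hu g) (hv g)
  zero_mem' := by
    intro g
    rw [SkewMonoidAlgebra.coeff_zero]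
    exact zero_mem _
  smul_mem' := by
    intro c u hu g
    rw [SkewMonoidAlgebra.coeff_smul]
    exact Submodule.smul_mem _ c (hu g)

end QuantumSpace

end QDiff

end

noncomputable section

namespace QDiff

/-! ### Monomials in quantum affine space -/

/-! The monomials `x_n^{a_n} ⋯ x_1^{a_1}` form a basis of `R` with one vector in each degree `a ∈
ℕ^n`. A homogeneous operator of degree `z` is therefore a function `c` on `ℕ^n`: it sends the
monomial of degree `a` to `ω(z, a) c(a)` times the monomial of degree `a + z`, where `ω` is the
bicharacter governing products of ordered monomials. With this normalization `ρ_I δ_J σ_γ` lives in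
degree `I - J` and has function a nonzero constant times `β(γ, a) binom(a, J)`
(`exists_coeffs_gen`). Ordinary binomials appear, rather than `q`-binomials, because `q_{ii} = 1`.
The commutator with `λ_{x_i}` has function `c(a + e_i) - c(a)`, up to a constant and the factor
`β(e_i, a)`.

A twisted commutator `[φ, ·]_a` becomes an untwisted one after replacing `φ` by `φ σ_{-a}`. Hence
raising the order by one means integrating a system of difference equations, and a function whose
differences are all quasi-polynomial (sums of characters `β(γ, ·)` times polynomials) of degree less
than `k` is quasi-polynomial of degree less than `k + 1` (`exists_quasiEval_eq`).

Conversely, a quasi-polynomial in degree `d` that comes from an operator vanishes wherever `a + d`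
leaves `ℕ^n`. For generic `q` and `n ≥ 3` the characters `β(γ, ·)` stay distinct on each hyperplane
`a_i = s` (`betaChar_injective`), so each polynomial factor vanishes there separately. This forces
`J + d ≥ 0` for every `binom(a, J)` that occurs, and each term is realized by `ρ_{J+d} δ_J σ_γ`
(`mem_opFil_of_coeffs`). By induction `D_q^m(R)` is the span of the `ρ_I δ_J σ_γ` with `|J| ≤ m`
(`DqBelow_eq_opFil`), which gives surjectivity and the filtration. Injectivity is the linear
independence of distinct characters over polynomials (`quasiEval_injective`). -/

theorem mul_prod_ofFn_pow {K A : Type*} [Field K] [Ring A] [Algebra K A] : ∀ {n : ℕ}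
    (y : Fin n → A) (p : Fin n → Fin n → K) (_ : ∀ i j, y i * y j = p i j • (y j * y i))
    (a : Fin n → ℕ) (i : Fin n),
    y i * (List.ofFn fun j => y j ^ a j).prod = (∏ j, (if j < i then p i j else 1) ^ a j) •
      (List.ofFn fun j => y j ^ (a + Pi.single i 1 : Fin n → ℕ) j).prod := by
  have hpow : ∀ {x z : A} {c : K} (_ : x * z = c • (z * x)) (k : ℕ),
      x * z ^ k = c ^ k • (z ^ k * x) := by
    intro x z c h k
    induction k with
    | zero => simp
    | succ k ih =>
      rw [pow_succ, ← mul_assoc, ih, smul_mul_assoc, mul_assoc, h, mul_smul_comm, smul_smul,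
        pow_succ, mul_assoc]
  intro n
  induction n with
  | zero => intro y p hp a i; exact i.elim0
  | succ n ih =>
    intro y p hp a i
    simp only [List.ofFn_succ, List.prod_cons, Fin.prod_univ_succ]
    refine Fin.cases ?_ (fun i => ?_) i
    · simp [← mul_assoc, pow_succ']
    -- For `i > 0` the factor `y_i` first passes `y_0^{a_0}`, at the cost `p_{i0}^{a_0}`; the
    -- remaining variables are handled by induction.
    · have h := ih (fun j => y j.succ) (fun i j => p i.succ j.succ)
        (fun i j => hp i.succ j.succ) (fun j => a j.succ) i
      rw [← mul_assoc, hpow (hp i.succ 0), smul_mul_assoc, mul_assoc, h, mul_smul_comm, smul_smul]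
      have e : ∀ j : Fin n, (a + Pi.single i.succ 1 : Fin (n + 1) → ℕ) j.succ =
          ((fun j => a j.succ) + Pi.single i 1 : Fin n → ℕ) j := by
        intro j; simp [Pi.single_apply]
      simp [e]

theorem exists_eq_add_single {n : ℕ} {a : Fin n → ℕ} {i : Fin n} (h : a i ≠ 0) :
    ∃ b : Fin n → ℕ, a = b + Pi.single i 1 := by
  have hle : Pi.single i 1 ≤ a := by
    intro j
    by_cases hj : j = i
    · subst hj; simp; omega
    · simp [hj]
  exact ⟨a - Pi.single i 1, (tsub_add_cancel_of_le hle).symm⟩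

theorem pi_nat_induction {n : ℕ} {p : (Fin n → ℕ) → Prop} (h0 : p 0)
    (h1 : ∀ a i, p a → p (a + Pi.single i 1)) (a : Fin n → ℕ) : p a := by
  have key : ∀ N, ∀ a : Fin n → ℕ, ∑ i, a i = N → p a := by
    intro N
    induction N with
    | zero =>
      intro a ha
      have : a = 0 := by ext i; simpa using (Finset.sum_eq_zero_iff.mp ha) i (Finset.mem_univ i)
      exact this ▸ h0
    | succ N ih =>
      intro a ha
      obtain ⟨i, hi⟩ : ∃ i, a i ≠ 0 := by
        by_contra! h
        simp [h] at ha
      obtain ⟨a, rfl⟩ := exists_eq_add_single hi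
      refine h1 _ _ (ih _ ?_)
      simp only [Pi.add_apply, Finset.sum_add_distrib] at ha
      simpa using ha
  exact key _ a rfl

/-- The inclusion `ℕ^n → ℤ^n`. -/
def natVec {n : ℕ} (a : Fin n → ℕ) : Fin n → ℤ := fun i => a i

section NatVec

variable {n : ℕ}

theorem natVec_zero : natVec (0 : Fin n → ℕ) = 0 := by ext i; simp [natVec]

theorem natVec_add (a b : Fin n → ℕ) : natVec (a + b) = natVec a + natVec b := by
  ext i; simp [natVec]

theorem natVec_single (i : Fin n) : natVec (Pi.single i 1) = stdVec i := by
  ext j; by_cases h : j = i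
  · subst h; simp [natVec, stdVec]
  · simp [natVec, stdVec, h]

theorem natVec_add_single (a : Fin n → ℕ) (i : Fin n) :
    natVec (a + Pi.single i 1) = natVec a + stdVec i := by
  rw [natVec_add, natVec_single]

theorem natVec_injective : Function.Injective (natVec (n := n)) := by
  intro a b h
  ext i
  simpa [natVec] using congrFun h i

end NatVec

section Monomials

variable {K : Type*} [Field K] {n : ℕ} (Q : QMatrix K n)

/-- The bicharacter `ω(d, a) = ∏_{j < i} q_{ji}^{d_i a_j}` with `ρ_I ρ_J = ω(I, J) ρ_{I + J}`. -/
def ordBichar : Bicharacter (Fin n → ℤ) K where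
  toFun a b := ∏ i, ∏ j, (if j < i then Q.q j i else 1) ^ (a i * b j)
  map_add_left a b c := by
    simp only [Pi.add_apply, add_mul, zpow_add, Finset.prod_mul_distrib]
  map_add_right a b c := by
    simp only [Pi.add_apply, mul_add, zpow_add, Finset.prod_mul_distrib]

theorem ordBichar_stdVec_natVec (i : Fin n) (a : Fin n → ℕ) :
    (ordBichar Q).toFun (stdVec i) (natVec a) =
      ∏ j, (if j < i then Q.q j i else 1) ^ a j := by
  simp only [ordBichar, stdVec]
  rw [Finset.prod_eq_single i]
  · simp [natVec]
  · intro b _ hb; simp [hb]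
  · simp

/-- Both `ω(b, a)` and `ω(a, b)` reorder the same product of two monomials, so `β` is the
antisymmetrization of `ω`. This identity makes left and right multiplication by `x_i` acquire the
same factor in `coeffs_lam_x_mul` and `coeffs_mul_lam_x`. -/
theorem natBichar_eq (a b : Fin n → ℤ) :
    (natBichar Q).toFun a b = (ordBichar Q).toFun b a * ((ordBichar Q).toFun a b)⁻¹ := by
  simp only [natBichar, ordBichar]
  rw [Finset.prod_comm (f := fun i j => (if j < i then Q.q j i else 1) ^ (b i * a j)),
    ← Finset.prod_inv_distrib, ← Finset.prod_mul_distrib]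
  refine Finset.prod_congr rfl fun i _ => ?_
  rw [← Finset.prod_inv_distrib, ← Finset.prod_mul_distrib]
  refine Finset.prod_congr rfl fun j _ => ?_
  rcases lt_trichotomy i j with h | h | h
  · simp [h, h.not_gt, mul_comm]
  · subst h; simp [Q.q_self]
  · simp [h, h.not_gt, Q.q_swap i j]

theorem natBichar_eq_prod (a : Fin n → ℤ) (b : Fin n → ℕ) :
    (natBichar Q).toFun a (natVec b) =
      ∏ j, (natBichar Q).toFun a (stdVec j) ^ b j := by
  induction b using pi_nat_induction with
  | h0 => simp [natVec_zero, toFun_zero_right]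
  | h1 b i ih =>
    rw [natVec_add_single, Bicharacter.map_add_right, ih]
    simp only [Pi.add_apply, pow_add, Finset.prod_mul_distrib]
    congr 1
    rw [Finset.prod_eq_single i]
    · simp
    · intro j _ hj; simp [hj]
    · simp

/-! ### Relations among `ρ_{x_i}`, `δ_i`, `σ_γ` and `λ_{x_i}`. -/

theorem rhoX_apply (i : Fin n) (r : QSpace Q) : rhoX Q i r = r * QSpace.x Q i := rfl

theorem rhoX_mul_rhoX (i j : Fin n) :
    rhoX Q i * rhoX Q j = ((Q.q j i : Kˣ) : K) • (rhoX Q j * rhoX Q i) := by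
  ext r
  simp only [Module.End.mul_apply, LinearMap.smul_apply, rhoX_apply, mul_assoc]
  rw [QSpace.x_mul_x Q j i, mul_smul_comm]

theorem rhoX_mul_rhoPow (i : Fin n) (I : Fin n → ℕ) :
    rhoX Q i * rhoPow Q I = (((ordBichar Q).toFun (stdVec i) (natVec I) : Kˣ) : K) •
      rhoPow Q (I + Pi.single i 1) := by
  rw [rhoPow, mul_prod_ofFn_pow (rhoX Q) (fun i j => ((Q.q j i : Kˣ) : K)) (rhoX_mul_rhoX Q),
    ordBichar_stdVec_natVec, rhoPow]
  congr 1
  push_cast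
  refine Finset.prod_congr rfl fun j _ => ?_
  split_ifs <;> simp

theorem rhoPow_add_single (i : Fin n) (I : Fin n → ℕ) :
    rhoPow Q (I + Pi.single i 1) =
      ((((ordBichar Q).toFun (stdVec i) (natVec I))⁻¹ : Kˣ) : K) • (rhoX Q i * rhoPow Q I) := by
  rw [rhoX_mul_rhoPow, smul_smul, Units.inv_mul, one_smul]

theorem rhoPow_zero : rhoPow Q 0 = 1 := by
  simp [rhoPow]

theorem deltaPow_zero : deltaPow Q 0 = 1 := by
  simp [deltaPow]

theorem delta_mul_rhoX (i j : Fin n) :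
    delta Q i * rhoX Q j =
      ((Q.q i j : Kˣ) : K) • (rhoX Q j * delta Q i) + if j = i then 1 else 0 := by
  ext r
  simp only [Module.End.mul_apply, LinearMap.smul_apply, rhoX_apply, LinearMap.add_apply]
  rw [delta_mul, delta_x, sigma_of_mem _ _ _ (x_mem_grading Q j), natBichar_stdVec, mul_smul_comm]
  split_ifs <;> simp

theorem eq_top_of_mul_x_mem (S : Submodule K (QSpace Q)) (h1 : 1 ∈ S)
    (hx : ∀ r ∈ S, ∀ i, r * QSpace.x Q i ∈ S) : S = ⊤ := by
  have key : ∀ r : QSpace Q, ∀ s ∈ S, s * r ∈ S := by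
    intro r
    induction r using QSpace.induction with
    | halg c =>
      intro s hs
      rw [← Algebra.commutes, ← Algebra.smul_def]
      exact S.smul_mem c hs
    | hx i => exact fun s hs => hx s hs i
    | hmul r r' hr hr' => intro s hs; rw [← mul_assoc]; exact hr' _ (hr _ hs)
    | hadd r r' hr hr' => intro s hs; rw [mul_add]; exact add_mem (hr _ hs) (hr' _ hs)
  exact eq_top_iff.mpr fun r _ => by simpa using key r 1 h1

/-- The defect `D` of the relation commutes with every `ρ_{x_k}` up to a scalar and kills `1`, so
its kernel is all of `R`. -/
theorem delta_mul_delta (i j : Fin n) :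
    delta Q i * delta Q j = ((Q.q j i : Kˣ) : K) • (delta Q j * delta Q i) := by
  have hs : ((Q.q j i : Kˣ) : K) * ((Q.q i j : Kˣ) : K) = 1 := by
    rw [← Units.val_mul, Q.q_swap i j]; simp
  set D := delta Q i * delta Q j - ((Q.q j i : Kˣ) : K) • (delta Q j * delta Q i) with hD
  have hcomm : ∀ k, D * rhoX Q k =
      (((Q.q i k : Kˣ) : K) * ((Q.q j k : Kˣ) : K)) • (rhoX Q k * D) := by
    intro k
    have h1 : ∀ i j, delta Q i * delta Q j * rhoX Q k =
        (((Q.q i k : Kˣ) : K) * ((Q.q j k : Kˣ) : K)) • (rhoX Q k * (delta Q i * delta Q j)) +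
          ((Q.q j k : Kˣ) : K) • ((if k = i then 1 else 0) * delta Q j) +
          delta Q i * (if k = j then 1 else 0) := by
      intro i j
      rw [mul_assoc, delta_mul_rhoX, mul_add, mul_smul_comm, ← mul_assoc, delta_mul_rhoX, add_mul,
        smul_mul_assoc, smul_add, smul_smul, mul_assoc, mul_comm ((Q.q j k : Kˣ) : K)]
    -- The inhomogeneous terms appear only for `k = i` or `k = j`, and there they cancel because
    -- `q_{ii} = 1` and `q_{ij} q_{ji} = 1`.
    rw [hD, sub_mul, smul_mul_assoc, h1, h1, mul_sub, smul_sub]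
    by_cases hi : k = i
    · subst hi
      by_cases hj : k = j
      · subst hj; simp [Q.q_self]
      · simp [hj, smul_smul, mul_comm, Q.q_self]
    · by_cases hj : k = j
      · subst hj
        rw [mul_comm] at hs
        simp [hi, smul_smul, mul_comm, Q.q_self, hs]
      · simp [hi, hj, smul_smul, mul_comm]
  have : LinearMap.ker D = ⊤ := by
    refine eq_top_of_mul_x_mem Q _ ?_ ?_
    · simp [hD, delta_one]
    · intro r hr k
      have h := LinearMap.congr_fun (hcomm k) r
      rw [Module.End.mul_apply, rhoX_apply] at h
      rw [LinearMap.mem_ker] at hr ⊢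
      rw [h]
      simp [hr]
  exact sub_eq_zero.mp (LinearMap.ker_eq_top.mp this)

/-- The `δ_i` satisfy the same commutation relations as the `ρ_{x_i}`, so the reordering constant is
again a value of `ω`; later arguments only need it to be a unit. -/
theorem exists_deltaPow_add_single (i : Fin n) (J : Fin n → ℕ) :
    ∃ k : Kˣ, deltaPow Q (J + Pi.single i 1) = (k : K) • (delta Q i * deltaPow Q J) := by
  refine ⟨((ordBichar Q).toFun (stdVec i) (natVec J))⁻¹, ?_⟩
  have h : delta Q i * deltaPow Q J = (((ordBichar Q).toFun (stdVec i) (natVec J) : Kˣ) : K) •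
      deltaPow Q (J + Pi.single i 1) := by
    rw [deltaPow, mul_prod_ofFn_pow (delta Q) (fun i j => ((Q.q j i : Kˣ) : K))
      (delta_mul_delta Q), ordBichar_stdVec_natVec, deltaPow]
    congr 1
    push_cast
    refine Finset.prod_congr rfl fun j _ => ?_
    split_ifs <;> simp
  rw [h, smul_smul, Units.inv_mul, one_smul]

/-- Since `x_i r = σ_{e_i}(r) x_i` holds on generators and passes to products, left multiplication
is already expressed by `ρ` and `σ`. -/
theorem lam_x (i : Fin n) : lam (QSpace.x Q i) = rhoX Q i * sig Q (stdVec i) := by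
  ext r
  change QSpace.x Q i * r = sig Q (stdVec i) r * QSpace.x Q i
  induction r using QSpace.induction with
  | halg c =>
    rw [Algebra.algebraMap_eq_smul_one, map_smul, sigma_of_mem _ _ _
      (SetLike.GradedOne.one_mem : (1 : QSpace Q) ∈ grading Q 0), toFun_zero_right]
    simp
  | hx j =>
    rw [sigma_of_mem _ _ _ (x_mem_grading Q j), natBichar_stdVec, smul_mul_assoc,
      QSpace.x_mul_x Q i j]
  | hmul r s hr hs => rw [← mul_assoc, hr, mul_assoc, hs, sigma_map_mul, mul_assoc]
  | hadd r s hr hs => rw [mul_add, hr, hs, map_add, add_mul]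

/-! ### The monomial basis and the action of `ρ_I` and `δ_J` on it. -/

/-- The monomial `ρ_{x_1}^{a_1} ⋯ ρ_{x_n}^{a_n}(1) = x_n^{a_n} ⋯ x_1^{a_1}`. -/
def monom (a : Fin n → ℕ) : QSpace Q := rhoPow Q a 1

theorem monom_zero : monom Q 0 = 1 := by simp [monom, rhoPow_zero]

theorem rhoX_monom (i : Fin n) (a : Fin n → ℕ) :
    rhoX Q i (monom Q a) = (((ordBichar Q).toFun (stdVec i) (natVec a) : Kˣ) : K) •
      monom Q (a + Pi.single i 1) := by
  rw [monom, ← Module.End.mul_apply, rhoX_mul_rhoPow]; rfl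

theorem monom_add_single (i : Fin n) (a : Fin n → ℕ) :
    monom Q (a + Pi.single i 1) =
      ((((ordBichar Q).toFun (stdVec i) (natVec a))⁻¹ : Kˣ) : K) • rhoX Q i (monom Q a) := by
  rw [rhoX_monom, smul_smul, Units.inv_mul, one_smul]

theorem monom_mem (a : Fin n → ℕ) : monom Q a ∈ grading Q (natVec a) := by
  induction a using pi_nat_induction with
  | h0 => rw [monom_zero, natVec_zero]; exact SetLike.GradedOne.one_mem
  | h1 a i ih =>
    rw [monom_add_single, natVec_add_single]
    exact Submodule.smul_mem _ _ (SetLike.mul_mem_graded ih (x_mem_grading Q i))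

theorem sig_monom (γ : Fin n → ℤ) (a : Fin n → ℕ) :
    sig Q γ (monom Q a) = (((natBichar Q).toFun γ (natVec a) : Kˣ) : K) • monom Q a :=
  sigma_of_mem _ _ _ (monom_mem Q a)

theorem lam_monom (i : Fin n) (a : Fin n → ℕ) :
    (lam (QSpace.x Q i) : Module.End K (QSpace Q)) (monom Q a) = (((natBichar Q).toFun (stdVec i) (natVec a) *
      (ordBichar Q).toFun (stdVec i) (natVec a) : Kˣ) : K) • monom Q (a + Pi.single i 1) := by
  rw [lam_x, Module.End.mul_apply, sig_monom, map_smul, rhoX_monom, smul_smul, Units.val_mul]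

theorem span_monom : Submodule.span K (Set.range (monom Q)) = ⊤ := by
  refine eq_top_of_mul_x_mem Q _ (Submodule.subset_span ⟨0, monom_zero Q⟩) fun r hr i => ?_
  refine Submodule.span_induction
    (p := fun r _ => rhoX Q i r ∈ Submodule.span K (Set.range (monom Q))) ?_ ?_ ?_ ?_ hr
  · rintro _ ⟨a, rfl⟩
    rw [rhoX_monom]
    exact Submodule.smul_mem _ _ (Submodule.subset_span ⟨_, rfl⟩)
  · simp
  · intro x y _ _ hx hy; rw [map_add]; exact add_mem hx hy
  · intro c x _ hx; rw [map_smul]; exact Submodule.smul_mem _ _ hx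

theorem rhoPow_monom (I a : Fin n → ℕ) :
    rhoPow Q I (monom Q a) = (((ordBichar Q).toFun (natVec I) (natVec a) : Kˣ) : K) •
      monom Q (a + I) := by
  induction I using pi_nat_induction with
  | h0 => simp [rhoPow_zero, natVec_zero, toFun_zero_left]
  | h1 I i ih =>
    rw [rhoPow_add_single, LinearMap.smul_apply, Module.End.mul_apply, ih, map_smul, rhoX_monom,
      smul_smul, smul_smul, natVec_add_single, natVec_add, Bicharacter.map_add_left,
      Bicharacter.map_add_right, add_assoc]
    congr 1
    rw [← Units.val_mul, ← Units.val_mul]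
    congr 1
    rw [mul_left_comm, ← mul_assoc, ← mul_assoc, mul_right_comm, inv_mul_cancel_right, mul_comm]

/-- `ρ_{x_i} δ_i` is an Euler operator: it commutes with `ρ_{x_j}` for `j ≠ i` since `q_{ij} q_{ji}
= 1`, and each `ρ_{x_i}` raises its eigenvalue by exactly one since `q_{ii} = 1`. -/
theorem rhoX_delta_monom (i : Fin n) (a : Fin n → ℕ) :
    rhoX Q i (delta Q i (monom Q a)) = (a i : K) • monom Q a := by
  induction a using pi_nat_induction with
  | h0 => simp [monom_zero, delta_one]
  | h1 a j ih =>
    have hs : ((Q.q i j : Kˣ) : K) * ((Q.q j i : Kˣ) : K) = 1 := by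
      rw [← Units.val_mul, Q.q_swap i j]; simp
    have hc : rhoX Q i * delta Q i * rhoX Q j = rhoX Q j * (rhoX Q i * delta Q i) +
        if j = i then rhoX Q j else 0 := by
      rw [mul_assoc, delta_mul_rhoX, mul_add, mul_smul_comm, ← mul_assoc, rhoX_mul_rhoX Q i j,
        smul_mul_assoc, smul_smul, hs, one_smul, mul_assoc]
      split_ifs with h
      · rw [h, mul_one]
      · rw [mul_zero]
    rw [monom_add_single, map_smul, map_smul]
    have := LinearMap.congr_fun hc (monom Q a)
    simp only [Module.End.mul_apply, LinearMap.add_apply] at this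
    rw [this, ih, map_smul, smul_comm]
    by_cases h : j = i
    · subst h
      simp only [if_true, Pi.add_apply, Pi.single_eq_same]
      push_cast
      module
    · have h' : i ≠ j := Ne.symm h
      simp [h, h']

theorem delta_monom_add_single (i : Fin n) (a : Fin n → ℕ) :
    delta Q i (monom Q (a + Pi.single i 1)) =
      (((a i : K) + 1) * (((ordBichar Q).toFun (-stdVec i) (natVec a) : Kˣ) : K)) •
        monom Q a := by
  have h := LinearMap.congr_fun (delta_mul_rhoX Q i i) (monom Q a)
  simp only [Module.End.mul_apply, LinearMap.add_apply, LinearMap.smul_apply, if_true,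
    Q.q_self, rhoX_delta_monom] at h
  rw [monom_add_single, map_smul, h, toFun_neg_left]
  simp only [Units.val_one, Module.End.one_apply]
  module

theorem delta_monom_eq_zero (i : Fin n) (a : Fin n → ℕ) (ha : a i = 0) :
    delta Q i (monom Q a) = 0 := by
  induction a using pi_nat_induction with
  | h0 => rw [monom_zero, delta_one]
  | h1 a j ih =>
    by_cases h : j = i
    · subst h; simp at ha
    · have hai : a i = 0 := by simp at ha; exact ha.1
      have hc := LinearMap.congr_fun (delta_mul_rhoX Q i j) (monom Q a)
      simp only [Module.End.mul_apply, LinearMap.smul_apply, if_neg h,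
        ih hai, map_zero, smul_zero, add_zero] at hc
      rw [monom_add_single, map_smul, hc, smul_zero]

instance : Nontrivial (QSpace Q) := by
  have f : QSpace Q →ₐ[K] K := QSpace.lift Q (fun _ => 0) (by simp)
  exact f.toRingHom.domain_nontrivial

/-- Nonvanishing descends along `δ_i`, which lowers the exponent with the factor `a_i + 1`, nonzero
in characteristic zero. As the degrees are distinct, linear independence of the monomials follows.
-/
theorem monom_ne_zero [CharZero K] (a : Fin n → ℕ) : monom Q a ≠ 0 := by
  induction a using pi_nat_induction with
  | h0 => rw [monom_zero]; exact one_ne_zero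
  | h1 a i ih =>
    intro h
    have h' := delta_monom_add_single Q i a
    rw [h, map_zero, eq_comm, smul_eq_zero] at h'
    rcases h' with h' | h'
    · rcases mul_eq_zero.mp h' with h' | h'
      · exact Nat.cast_add_one_ne_zero _ h'
      · exact Units.ne_zero _ h'
    · exact ih h'

theorem linearIndependent_monom [CharZero K] : LinearIndependent K (monom Q) :=
  ((DirectSum.Decomposition.isInternal (grading Q)).submodule_iSupIndep.comp natVec_injective).linearIndependent _
    (monom_mem Q) (monom_ne_zero Q)

/-- The basis of monomials of quantum affine space. -/
def monomBasis [CharZero K] : Module.Basis (Fin n → ℕ) K (QSpace Q) :=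
  Module.Basis.mk (linearIndependent_monom Q) (span_monom Q).ge

theorem monomBasis_apply [CharZero K] (a : Fin n → ℕ) : monomBasis Q a = monom Q a := by
  simp [monomBasis]

/-- The product of the binomial coefficients `binom(a_i, J_i)`. -/
def multiChoose (a J : Fin n → ℕ) : ℕ := ∏ i, (a i).choose (J i)

theorem multiChoose_eq_zero {a J : Fin n → ℕ} (h : ¬ J ≤ a) : multiChoose a J = 0 := by
  obtain ⟨i, hi⟩ : ∃ i, a i < J i := by simpa [Pi.le_def] using h
  exact Finset.prod_eq_zero (Finset.mem_univ i) (Nat.choose_eq_zero_of_lt hi)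

theorem multiChoose_zero (a : Fin n → ℕ) : multiChoose a 0 = 1 := by
  simp [multiChoose]

theorem multiChoose_self (a : Fin n → ℕ) : multiChoose a a = 1 := by
  simp [multiChoose]

theorem multiChoose_split (a J : Fin n → ℕ) (i : Fin n) :
    multiChoose a J = (a i).choose (J i) * ∏ j ∈ Finset.univ.erase i, (a j).choose (J j) :=
  (Finset.mul_prod_erase _ _ (Finset.mem_univ i)).symm

theorem multiChoose_congr_erase {a a' J J' : Fin n → ℕ} {i : Fin n}
    (h : ∀ j, j ≠ i → a j = a' j ∧ J j = J' j) :
    ∏ j ∈ Finset.univ.erase i, (a j).choose (J j) =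
      ∏ j ∈ Finset.univ.erase i, (a' j).choose (J' j) :=
  Finset.prod_congr rfl fun j hj => by
    rw [(h j (Finset.ne_of_mem_erase hj)).1, (h j (Finset.ne_of_mem_erase hj)).2]

theorem multiChoose_mul_succ (b J : Fin n → ℕ) (i : Fin n) :
    multiChoose (b + Pi.single i 1 + J) J * (b i + 1) =
      multiChoose (b + (J + Pi.single i 1)) (J + Pi.single i 1) * (J i + 1) := by
  rw [multiChoose_split _ _ i, multiChoose_split _ (J + Pi.single i 1) i,
    multiChoose_congr_erase (a := b + Pi.single i 1 + J) (a' := b + (J + Pi.single i 1))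
      (J := J) (J' := J + Pi.single i 1) (i := i) (by intro j hj; simp [hj])]
  have h := Nat.choose_succ_right_eq (b i + 1 + J i) (J i)
  have e : b i + 1 + J i - J i = b i + 1 := by omega
  rw [e] at h
  simp only [Pi.add_apply, Pi.single_eq_same]
  rw [mul_right_comm, ← h, mul_right_comm]
  have e' : b i + (J i + 1) = b i + 1 + J i := by omega
  rw [e', mul_right_comm]

/-- The constant `k` does not depend on `b`: the whole dependence on the monomial is a binomial
coefficient and a value of `ω`, which is what makes the normalized coefficient function polynomial.
-/
theorem exists_deltaPow_monom [CharZero K] (J : Fin n → ℕ) : ∃ k : K, k ≠ 0 ∧ ∀ b,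
    deltaPow Q J (monom Q (b + J)) = (k * (multiChoose (b + J) J : K) *
      (((ordBichar Q).toFun (-natVec J) (natVec b) : Kˣ) : K)) • monom Q b := by
  induction J using pi_nat_induction with
  | h0 =>
    exact ⟨1, one_ne_zero, fun b => by
      simp [deltaPow_zero, multiChoose_zero, natVec_zero, toFun_zero_left]⟩
  | h1 J i ih =>
    obtain ⟨k, hk, h⟩ := ih
    obtain ⟨c, hc⟩ := exists_deltaPow_add_single Q i J
    refine ⟨c * k * (((ordBichar Q).toFun (-natVec J) (stdVec i) : Kˣ) : K) * ((J i : K) + 1),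
      ?_, fun b => ?_⟩
    · exact mul_ne_zero (mul_ne_zero (mul_ne_zero c.ne_zero hk) (Units.ne_zero _))
        (Nat.cast_add_one_ne_zero _)
    · have e : b + (J + Pi.single i 1) = b + Pi.single i 1 + J := by abel
      rw [hc, LinearMap.smul_apply, Module.End.mul_apply]
      nth_rewrite 1 [e]
      rw [h, map_smul, delta_monom_add_single, smul_smul, smul_smul, natVec_add_single,
        natVec_add_single, neg_add, Bicharacter.map_add_left, Bicharacter.map_add_right]
      congr 1
      have hm := congrArg (Nat.cast : ℕ → K) (multiChoose_mul_succ b J i)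
      push_cast at hm ⊢
      linear_combination c * k * (((ordBichar Q).toFun (-natVec J) (stdVec i) : Kˣ) : K) *
        (((ordBichar Q).toFun (-natVec J) (natVec b) : Kˣ) : K) *
        (((ordBichar Q).toFun (-stdVec i) (natVec b) : Kˣ) : K) * hm

theorem deltaPow_monom_eq_zero [CharZero K] (J a : Fin n → ℕ) (h : ¬ J ≤ a) :
    deltaPow Q J (monom Q a) = 0 := by
  induction J using pi_nat_induction with
  | h0 => exact absurd (fun i => Nat.zero_le _) h
  | h1 J i ih =>
    obtain ⟨c, hc⟩ := exists_deltaPow_add_single Q i J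
    rw [hc, LinearMap.smul_apply, Module.End.mul_apply]
    by_cases hJ : J ≤ a
    · obtain ⟨b, rfl⟩ : ∃ b, a = b + J := ⟨a - J, (tsub_add_cancel_of_le hJ).symm⟩
      obtain ⟨k, -, hk⟩ := exists_deltaPow_monom Q J
      -- Here `J ≤ a` but `J + e_i` is not, so `δ_J` has already used up all factors `x_i`.
      have hb : b i = 0 := by
        by_contra hb
        refine h fun j => ?_
        by_cases hj : j = i
        · subst hj; simp; omega
        · simp [hj]
      rw [hk, map_smul, delta_monom_eq_zero Q i b hb, smul_zero, smul_zero]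
    · rw [ih hJ, map_zero, smul_zero]

end Monomials

/-! ### Quasi-polynomial functions on `ℕ^n` -/

section QuasiPoly

variable {K : Type*} [Field K] {n : ℕ}

theorem multiChoose_add_single_of_eq_zero (a J : Fin n → ℕ) (i : Fin n) (h : J i = 0) :
    multiChoose (a + Pi.single i 1) J = multiChoose a J := by
  rw [multiChoose_split _ _ i, multiChoose_split a _ i, h,
    multiChoose_congr_erase (a := a + Pi.single i 1) (a' := a) (J := J) (J' := J) (i := i)
      (by intro j hj; simp [hj])]
  simp

theorem multiChoose_add_single_add_single (a J : Fin n → ℕ) (i : Fin n) :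
    multiChoose (a + Pi.single i 1) (J + Pi.single i 1) =
      multiChoose a (J + Pi.single i 1) + multiChoose a J := by
  rw [multiChoose_split _ _ i, multiChoose_split a _ i, multiChoose_split a J i,
    multiChoose_congr_erase (a := a + Pi.single i 1) (a' := a)
      (J := J + Pi.single i 1) (J' := J) (i := i) (by intro j hj; simp [hj]),
    multiChoose_congr_erase (a := a) (a' := a)
      (J := J + Pi.single i 1) (J' := J) (i := i) (by intro j hj; simp [hj]), ← add_mul]
  simp only [Pi.add_apply, Pi.single_eq_same]
  rw [Nat.choose_succ_succ', add_comm]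

/-! ### Polynomial functions in the binomial basis and their differences. -/

/-- The polynomial function `a ↦ ∑ J, g J * binom(a, J)`. -/
def polyEval : ((Fin n → ℕ) →₀ K) →ₗ[K] ((Fin n → ℕ) → K) :=
  Finsupp.linearCombination K fun J a => (multiChoose a J : K)

theorem polyEval_single (J : Fin n → ℕ) (c : K) (a : Fin n → ℕ) :
    polyEval (Finsupp.single J c) a = c * (multiChoose a J : K) := by
  simp [polyEval]

theorem polyEval_apply (g : (Fin n → ℕ) →₀ K) (a : Fin n → ℕ) :
    polyEval g a = g.sum fun J c => c * (multiChoose a J : K) := by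
  simp [polyEval, Finsupp.linearCombination_apply, Finsupp.sum, Finset.sum_apply]

/-- The shift of coefficients `(S_i g)(J) = g(J + e_i)`. -/
def coeffShift (i : Fin n) : Module.End K ((Fin n → ℕ) →₀ K) :=
  Finsupp.lcomapDomain (fun J => J + Pi.single i 1) (add_left_injective _)

theorem coeffShift_apply (i : Fin n) (g : (Fin n → ℕ) →₀ K) (J : Fin n → ℕ) :
    coeffShift i g J = g (J + Pi.single i 1) := rfl

/-- Pascal's rule: in the binomial basis the difference operator is just a shift of coefficients,
hence nilpotent in bounded degree. -/
theorem polyEval_add_single (i : Fin n) (g : (Fin n → ℕ) →₀ K) (a : Fin n → ℕ) :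
    polyEval g (a + Pi.single i 1) = polyEval g a + polyEval (coeffShift i g) a := by
  induction g using Finsupp.induction_linear with
  | zero => simp
  | add f g hf hg =>
    simp only [map_add, Pi.add_apply] at hf hg ⊢
    rw [hf, hg]; ring
  | single J c =>
    by_cases h : J i = 0
    · have : coeffShift i (Finsupp.single J c) = 0 := by
        ext J'
        rw [coeffShift_apply, Finsupp.single_apply, if_neg]
        · rfl
        · rintro rfl; simp at h
      rw [this, polyEval_single, polyEval_single, multiChoose_add_single_of_eq_zero _ _ _ h]
      simp
    · obtain ⟨J, rfl⟩ := exists_eq_add_single h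
      have : coeffShift i (Finsupp.single (J + Pi.single i 1) c) = Finsupp.single J c := by
        ext J'
        simp [coeffShift_apply, Finsupp.single_apply]
      rw [this, polyEval_single, polyEval_single, polyEval_single,
        multiChoose_add_single_add_single]
      push_cast; ring

/-- The coefficients of polynomial functions of degree less than `k`. -/
def degLT (K : Type*) [Field K] (n k : ℕ) : Submodule K ((Fin n → ℕ) →₀ K) :=
  Finsupp.supported K K {J | ∑ i, J i < k}

theorem mem_degLT {k : ℕ} {g : (Fin n → ℕ) →₀ K} :
    g ∈ degLT K n k ↔ ∀ J, k ≤ ∑ i, J i → g J = 0 := by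
  simp [degLT, Finsupp.mem_supported']

theorem degLT_mono {k l : ℕ} (h : k ≤ l) : degLT K n k ≤ degLT K n l :=
  fun _ hg => mem_degLT.mpr fun J hJ => mem_degLT.mp hg J (h.trans hJ)

theorem sum_add_single (J : Fin n → ℕ) (i : Fin n) :
    ∑ j, (J + Pi.single i 1 : Fin n → ℕ) j = ∑ j, J j + 1 := by
  simp [Finset.sum_add_distrib]

theorem coeffShift_mem_degLT {k : ℕ} {g : (Fin n → ℕ) →₀ K} (i : Fin n)
    (h : g ∈ degLT K n (k + 1)) : coeffShift i g ∈ degLT K n k := by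
  refine mem_degLT.mpr fun J hJ => ?_
  rw [coeffShift_apply]
  exact mem_degLT.mp h _ (by rw [sum_add_single]; omega)

theorem coeffShift_mem_degLT_self {k : ℕ} {g : (Fin n → ℕ) →₀ K} (i : Fin n)
    (h : g ∈ degLT K n k) : coeffShift i g ∈ degLT K n k :=
  coeffShift_mem_degLT i (degLT_mono (Nat.le_succ k) h)

theorem degLT_zero : degLT K n 0 = ⊥ := by
  refine eq_bot_iff.mpr fun g hg => ?_
  ext J
  exact mem_degLT.mp hg J (Nat.zero_le _)

theorem coeffShift_pow_eq_zero (i : Fin n) {k : ℕ} {g : (Fin n → ℕ) →₀ K}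
    (h : g ∈ degLT K n k) : (coeffShift i ^ k) g = 0 := by
  induction k generalizing g with
  | zero => simpa [degLT_zero] using h
  | succ k ih =>
    rw [pow_succ, Module.End.mul_apply]
    exact ih (coeffShift_mem_degLT i h)

theorem exists_mem_degLT (g : (Fin n → ℕ) →₀ K) : ∃ k, g ∈ degLT K n k := by
  refine ⟨g.support.sup (fun J => ∑ i, J i) + 1, mem_degLT.mpr fun J hJ => ?_⟩
  by_contra h
  have := Finset.le_sup (f := fun J : Fin n → ℕ => ∑ i, J i) (Finsupp.mem_support_iff.mpr h)
  omega

theorem coeffShift_commute (i j : Fin n) :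
    Commute (coeffShift i : Module.End K ((Fin n → ℕ) →₀ K)) (coeffShift j) := by
  refine LinearMap.ext fun g => Finsupp.ext fun J => ?_
  simp only [Module.End.mul_apply, coeffShift_apply, add_right_comm]

/-- A polynomial function that vanishes where `a_i < t` has no `binom(a, J)` with `J_i < t`. -/
theorem coeff_eq_zero_of_polyEval (g : (Fin n → ℕ) →₀ K) (i : Fin n) (t : ℕ)
    (h : ∀ a : Fin n → ℕ, a i < t → polyEval g a = 0) (J : Fin n → ℕ) (hJ : J i < t) :
    g J = 0 := by
  induction J using WellFoundedLT.induction with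
  | ind J ih =>
    -- The system is triangular: at the point `a = J` only `J' ≤ J` contribute, the smaller ones
    -- vanish by induction, and `binom(J, J) = 1`.
    rw [← h J hJ, polyEval_apply, Finsupp.sum, Finset.sum_eq_single J]
    · simp [multiChoose_self]
    · intro J' _ hne
      by_cases hle : J' ≤ J
      · rw [ih J' (lt_of_le_of_ne hle hne) ((hle i).trans_lt hJ), zero_mul]
      · rw [multiChoose_eq_zero hle, Nat.cast_zero, mul_zero]
    · intro hJ'
      simpa [multiChoose_self] using hJ'

/-! ### A single character times a polynomial: solving the difference equations. -/

/-- The character `a ↦ ∏ j, q_j ^ a_j` of `ℕ^n`. -/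
def charFun (q : Fin n → Kˣ) (a : Fin n → ℕ) : K := ((∏ j, q j ^ a j : Kˣ) : K)

theorem charFun_ne_zero (q : Fin n → Kˣ) (a : Fin n → ℕ) : charFun q a ≠ 0 := Units.ne_zero _

theorem charFun_add_single (q : Fin n → Kˣ) (a : Fin n → ℕ) (i : Fin n) :
    charFun q (a + Pi.single i 1) = q i * charFun q a := by
  rw [charFun, charFun, ← Units.val_mul]
  congr 1
  simp only [Pi.add_apply, pow_add, Finset.prod_mul_distrib]
  rw [mul_comm]
  congr 1
  rw [Finset.prod_eq_single i]
  · simp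
  · intro j _ hj; simp [hj]
  · simp

/-- The operator on coefficients corresponding to `f ↦ f(· + e_i) - f` on functions of the form
character times polynomial. -/
def twistDiff (q : Kˣ) (i : Fin n) : Module.End K ((Fin n → ℕ) →₀ K) :=
  ((q : K) - 1) • 1 + (q : K) • coeffShift i

theorem twistDiff_apply (q : Kˣ) (i : Fin n) (g : (Fin n → ℕ) →₀ K) :
    twistDiff q i g = ((q : K) - 1) • g + (q : K) • coeffShift i g := rfl

theorem charFun_mul_polyEval_add_single (q : Fin n → Kˣ) (g : (Fin n → ℕ) →₀ K) (i : Fin n)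
    (a : Fin n → ℕ) :
    charFun q (a + Pi.single i 1) * polyEval g (a + Pi.single i 1) - charFun q a * polyEval g a =
      charFun q a * polyEval (twistDiff (q i) i g) a := by
  rw [charFun_add_single, polyEval_add_single, twistDiff_apply, map_add, map_smul, map_smul]
  simp only [Pi.add_apply, Pi.smul_apply, smul_eq_mul]
  ring

theorem twistDiff_mem_degLT {k : ℕ} {g : (Fin n → ℕ) →₀ K} (q : Kˣ) (i : Fin n)
    (h : g ∈ degLT K n k) : twistDiff q i g ∈ degLT K n k := by
  rw [twistDiff_apply]
  exact add_mem (Submodule.smul_mem _ _ h) (Submodule.smul_mem _ _ (coeffShift_mem_degLT_self i h))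

theorem twistDiff_commute (q q' : Kˣ) (i j : Fin n) :
    Commute (twistDiff q i) (twistDiff q' j) := by
  have h := coeffShift_commute (K := K) i j
  have h1 : ∀ (c : K) (x : Module.End K ((Fin n → ℕ) →₀ K)), Commute (c • 1) x :=
    fun c x => (Commute.one_left x).smul_left c
  exact Commute.add_left (h1 _ _)
    (Commute.add_right (h1 _ _).symm ((h.smul_left _).smul_right _))

/-- For `q ≠ 1` the operator is a nonzero scalar times `1` minus a locally nilpotent one, so a
finite geometric series inverts it without raising the degree. -/
theorem twistDiff_eq_mul (q : Kˣ) (i : Fin n) (hq : (q : K) ≠ 1) :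
    (twistDiff q i : Module.End K ((Fin n → ℕ) →₀ K)) =
      ((q : K) - 1) • (1 - (-((q : K) / (q - 1))) • coeffShift i) := by
  have h : (q : K) - 1 ≠ 0 := sub_ne_zero.mpr hq
  refine LinearMap.ext fun g => ?_
  simp only [twistDiff_apply, LinearMap.smul_apply, LinearMap.sub_apply, Module.End.one_apply]
  rw [smul_sub, smul_smul, mul_neg, mul_div_cancel₀ _ h, neg_smul, sub_neg_eq_add]

theorem twistDiff_injective (q : Kˣ) (i : Fin n) (hq : (q : K) ≠ 1)
    {g : (Fin n → ℕ) →₀ K} (h : twistDiff q i g = 0) : g = 0 := by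
  rw [twistDiff_eq_mul q i hq, LinearMap.smul_apply,
    smul_eq_zero_iff_right (sub_ne_zero.mpr hq)] at h
  set y : Module.End K ((Fin n → ℕ) →₀ K) := (-((q : K) / (q - 1))) • coeffShift i with hy
  obtain ⟨k, hk⟩ := exists_mem_degLT g
  have h1 : (y ^ k) g = 0 := by
    rw [hy, smul_pow, LinearMap.smul_apply, coeffShift_pow_eq_zero i hk, smul_zero]
  have h2 := LinearMap.congr_fun (geom_sum_mul_neg y k) g
  rw [Module.End.mul_apply, h, map_zero, LinearMap.sub_apply, h1, sub_zero] at h2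
  exact h2.symm

theorem exists_twistDiff_eq_of_ne_one (q : Kˣ) (i : Fin n) (hq : (q : K) ≠ 1) {k : ℕ}
    {p : (Fin n → ℕ) →₀ K} (hp : p ∈ degLT K n k) : ∃ g ∈ degLT K n k, twistDiff q i g = p := by
  have hq' := sub_ne_zero.mpr hq
  set y : Module.End K ((Fin n → ℕ) →₀ K) := (-((q : K) / (q - 1))) • coeffShift i with hy
  refine ⟨((q : K) - 1)⁻¹ • (∑ l ∈ Finset.range k, y ^ l) p, Submodule.smul_mem _ _ ?_, ?_⟩
  · rw [LinearMap.sum_apply]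
    refine Submodule.sum_mem _ fun l _ => ?_
    rw [hy, smul_pow, LinearMap.smul_apply]
    refine Submodule.smul_mem _ _ ?_
    clear * - hp
    induction l with
    | zero => simpa using hp
    | succ l ih =>
      rw [pow_succ', Module.End.mul_apply]
      exact coeffShift_mem_degLT_self i ih
  · have h1 : (y ^ k) p = 0 := by
      rw [hy, smul_pow, LinearMap.smul_apply, coeffShift_pow_eq_zero i hp, smul_zero]
    have h2 := LinearMap.congr_fun (mul_neg_geom_sum y k) p
    rw [Module.End.mul_apply, LinearMap.sub_apply (1 : Module.End K _) (y ^ k), h1,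
      sub_zero] at h2
    rw [twistDiff_eq_mul q i hq, LinearMap.smul_apply, map_smul, smul_smul, mul_inv_cancel₀ hq',
      one_smul, h2]
    rfl

/-- The coefficients of `g` are prescribed by `g(J + e_i) = p_i(J)`; compatibility makes this
independent of `i`. The coefficient at `0` is free and is set to zero, and the degree rises by one.
-/
theorem exists_coeffShift_eq {k : ℕ} (p : Fin n → (Fin n → ℕ) →₀ K)
    (hp : ∀ i, p i ∈ degLT K n k) (hc : ∀ i j, coeffShift j (p i) = coeffShift i (p j)) :
    ∃ g ∈ degLT K n (k + 1), ∀ i, coeffShift i g = p i := by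
  classical
  set G : (Fin n → ℕ) → K := fun J =>
    if h : ∃ i, J i ≠ 0 then p h.choose (J - Pi.single h.choose 1) else 0 with hG
  have hG1 : ∀ J i, G (J + Pi.single i 1) = p i J := by
    intro J i
    have h : ∃ j, (J + Pi.single i 1 : Fin n → ℕ) j ≠ 0 := ⟨i, by simp⟩
    rw [hG]
    simp only [dif_pos h]
    generalize hj : h.choose = j
    have hj' : (J + Pi.single i 1 : Fin n → ℕ) j ≠ 0 := hj ▸ h.choose_spec
    -- `j` is the index that `G` happened to choose; if it differs from `i`, both can be removed
    -- from `J` and compatibility compares the two values.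
    by_cases hij : j = i
    · subst hij; simp
    · obtain ⟨J, rfl⟩ := exists_eq_add_single (a := J) (i := j) (by simpa [hij] using hj')
      rw [add_right_comm, add_tsub_cancel_right]
      exact DFunLike.congr_fun (hc j i) J
  have hG2 : ∀ J, k + 1 ≤ ∑ i, J i → G J = 0 := by
    intro J hJ
    obtain ⟨i, hi⟩ : ∃ i, J i ≠ 0 := by
      by_contra! h
      simp [h] at hJ
    obtain ⟨J, rfl⟩ := exists_eq_add_single hi
    rw [hG1]
    rw [sum_add_single] at hJ
    exact mem_degLT.mp (hp i) J (by omega)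
  have hfin : (Function.support G).Finite := by
    refine (Set.finite_Iic (fun _ : Fin n => k)).subset fun J hJ i => ?_
    by_contra! hi
    exact hJ (hG2 J (hi.trans_le (Finset.single_le_sum (f := J) (fun _ _ => Nat.zero_le _)
      (Finset.mem_univ i))))
  exact ⟨Finsupp.ofSupportFinite G hfin, mem_degLT.mpr hG2, fun i => Finsupp.ext fun J => hG1 J i⟩

/-- If every `q_i` is `1` these are ordinary difference equations. Otherwise the equation for one
`q_i ≠ 1` has a unique solution, and it satisfies the others because the operators commute and the
`i`-th one is injective. -/
theorem exists_twistDiff_eq {k : ℕ} (q : Fin n → Kˣ) (p : Fin n → (Fin n → ℕ) →₀ K)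
    (hp : ∀ i, p i ∈ degLT K n k)
    (hc : ∀ i j, twistDiff (q j) j (p i) = twistDiff (q i) i (p j)) :
    ∃ g ∈ degLT K n (k + 1), ∀ i, twistDiff (q i) i g = p i := by
  by_cases h : ∀ i, (q i : K) = 1
  · have hD : ∀ i (g : (Fin n → ℕ) →₀ K), twistDiff (q i) i g = coeffShift i g := by
      intro i g
      rw [twistDiff_apply, h]; simp
    simp only [hD] at hc ⊢
    exact exists_coeffShift_eq p hp hc
  · push Not at h
    obtain ⟨i, hi⟩ := h
    obtain ⟨g, hg, hgp⟩ := exists_twistDiff_eq_of_ne_one (q i) i hi (hp i)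
    refine ⟨g, degLT_mono (Nat.le_succ k) hg, fun j => sub_eq_zero.mp ?_⟩
    refine twistDiff_injective (q i) i hi ?_
    rw [map_sub, ← Module.End.mul_apply, (twistDiff_commute _ _ _ _).eq, Module.End.mul_apply, hgp,
      hc, sub_self]

/-! ### Sums over several characters: uniqueness and integration. -/

variable {Γ : Type*} (χ : Γ → Fin n → Kˣ)

/-- The quasi-polynomial function `∑ γ, χ_γ * polyEval (u γ)`. -/
def quasiEval : (Γ →₀ (Fin n → ℕ) →₀ K) →ₗ[K] ((Fin n → ℕ) → K) :=
  Finsupp.lsum K fun γ => LinearMap.mulLeft K (charFun (χ γ)) ∘ₗ polyEval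

theorem quasiEval_single (γ : Γ) (g : (Fin n → ℕ) →₀ K) (a : Fin n → ℕ) :
    quasiEval χ (Finsupp.single γ g) a = charFun (χ γ) a * polyEval g a := by
  simp [quasiEval]

theorem quasiEval_eq_sum_of_subset (u : Γ →₀ (Fin n → ℕ) →₀ K) {s : Finset Γ}
    (h : u.support ⊆ s) :
    quasiEval χ u = ∑ γ ∈ s, charFun (χ γ) * polyEval (u γ) := by
  rw [quasiEval, Finsupp.lsum_apply, Finsupp.sum_of_support_subset _ h _ (by simp)]
  rfl

theorem quasiEval_apply (u : Γ →₀ (Fin n → ℕ) →₀ K) (a : Fin n → ℕ) :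
    quasiEval χ u a = ∑ γ ∈ u.support, charFun (χ γ) a * polyEval (u γ) a := by
  rw [quasiEval_eq_sum_of_subset χ u subset_rfl, Finset.sum_apply]
  rfl

/-- The operator on coefficients corresponding to `f ↦ f(· + e_i) - f` on quasi-polynomials. -/
def quasiDiff (i : Fin n) (u : Γ →₀ (Fin n → ℕ) →₀ K) : Γ →₀ (Fin n → ℕ) →₀ K :=
  Finsupp.onFinset u.support (fun γ => twistDiff (χ γ i) i (u γ)) fun γ h => by
    rw [Finsupp.mem_support_iff]
    rintro h'
    exact h (by rw [h', map_zero])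

theorem quasiDiff_apply (i : Fin n) (u : Γ →₀ (Fin n → ℕ) →₀ K) (γ : Γ) :
    quasiDiff χ i u γ = twistDiff (χ γ i) i (u γ) := rfl

theorem quasiEval_quasiDiff (i : Fin n) (u : Γ →₀ (Fin n → ℕ) →₀ K) (a : Fin n → ℕ) :
    quasiEval χ (quasiDiff χ i u) a = quasiEval χ u (a + Pi.single i 1) - quasiEval χ u a := by
  have hs : (quasiDiff χ i u).support ⊆ u.support := Finsupp.support_onFinset_subset
  rw [quasiEval_apply χ u, quasiEval_apply χ u, quasiEval_eq_sum_of_subset χ _ hs,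
    Finset.sum_apply, ← Finset.sum_sub_distrib]
  exact Finset.sum_congr rfl fun γ _ =>
    (charFun_mul_polyEval_add_single (χ γ) (u γ) i a).symm

/-- The translation `f ↦ f(· + e_i)` on functions on `ℕ^n`. -/
def funShift (K : Type*) [Field K] {n : ℕ} (i : Fin n) : Module.End K ((Fin n → ℕ) → K) :=
  LinearMap.funLeft K K fun a => a + Pi.single i 1

/-- Subtracting `q_i` from the translation acts on character times polynomial as `q_i` times the
coefficient shift, and the shift is nilpotent on a given polynomial. -/
theorem charFun_mul_polyEval_mem (q : Fin n → Kˣ) (g : (Fin n → ℕ) →₀ K) (i : Fin n) :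
    charFun q * polyEval g ∈ (funShift K i).maxGenEigenspace (q i : K) := by
  have key : ∀ N, ((funShift K i - (q i : K) • 1) ^ N) (charFun q * polyEval g) =
      (q i : K) ^ N • (charFun q * polyEval ((coeffShift i ^ N) g)) := by
    intro N
    induction N with
    | zero => simp
    | succ N ih =>
      rw [pow_succ', Module.End.mul_apply, ih, pow_succ' (coeffShift i), Module.End.mul_apply]
      ext a
      simp only [map_smul, LinearMap.sub_apply, LinearMap.smul_apply, Module.End.one_apply,
        funShift, LinearMap.funLeft_apply, Pi.smul_apply, Pi.sub_apply, Pi.mul_apply, smul_eq_mul,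
        charFun_add_single, polyEval_add_single]
      ring
  obtain ⟨k, hk⟩ := exists_mem_degLT g
  rw [Module.End.mem_maxGenEigenspace]
  exact ⟨k, by rw [key, coeffShift_pow_eq_zero i hk, map_zero, mul_zero, smul_zero]⟩

/-- If the characters `χ_γ` are distinguished by their values at `e_j`, `j ≠ i`, then the terms of
a quasi-polynomial that vanishes on the hyperplane `a_i = s` vanish there. -/
theorem polyEval_eq_zero_of_quasiEval (i : Fin n) (s : ℕ)
    (hχ : Function.Injective fun γ (j : {j // j ≠ i}) => χ γ j) (u : Γ →₀ (Fin n → ℕ) →₀ K)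
    (h : ∀ a : Fin n → ℕ, a i = s → quasiEval χ u a = 0) (γ : Γ) (a : Fin n → ℕ) (ha : a i = s) :
    polyEval (u γ) a = 0 := by
  classical
  -- `R` freezes the `i`-th coordinate at `s`. It commutes with translations in the other
  -- directions, so restricted terms remain in the simultaneous generalized eigenspaces of those
  -- translations, which are independent for different characters.
  set R : Module.End K ((Fin n → ℕ) → K) :=
    LinearMap.funLeft K K fun a => Function.update a i s with hR
  have hind : iSupIndep fun q : {j // j ≠ i} → K =>
      ⨅ j : {j // j ≠ i}, (funShift K j.1).maxGenEigenspace (q j) := by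
    refine Module.End.independent_iInf_maxGenEigenspace_of_forall_mapsTo _ fun j l q =>
      Module.End.mapsTo_maxGenEigenspace_of_comm ?_ q
    refine LinearMap.ext fun f => funext fun b => ?_
    simp only [Module.End.mul_apply, funShift, LinearMap.funLeft_apply, add_right_comm]
  have hind' := hind.comp (f := fun (γ : Γ) (j : {j // j ≠ i}) => (χ γ j : K)) (by
    intro γ γ' hγ
    refine hχ (funext fun j => Units.ext (congrFun hγ j)))
  rw [iSupIndep_iff_finsetSum_eq_zero_imp_eq_zero] at hind'
  by_cases hγ : γ ∈ u.support
  swap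
  · rw [Finsupp.notMem_support_iff.mp hγ, map_zero]; rfl
  have hz := hind' u.support (fun γ => R (charFun (χ γ) * polyEval (u γ))) ?_ ?_ γ hγ
  · have := congrFun hz a
    simp only [hR, LinearMap.funLeft_apply] at this
    rw [← ha, Function.update_eq_self] at this
    exact (mul_eq_zero.mp this).resolve_left (charFun_ne_zero _ _)
  · intro γ _
    simp only [Function.comp_apply, Submodule.mem_iInf]
    intro j
    refine Module.End.mapsTo_maxGenEigenspace_of_comm ?_ _ (charFun_mul_polyEval_mem _ _ _)
    refine LinearMap.ext fun f => funext fun b => ?_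
    simp only [Module.End.mul_apply, funShift, hR, LinearMap.funLeft_apply]
    congr 1
    ext l
    by_cases hl : l = i
    · subst hl; simp [Ne.symm j.2]
    · simp [hl]
  · rw [← map_sum, ← quasiEval_eq_sum_of_subset χ u subset_rfl]
    ext b
    exact h _ (by simp)

/-- Every point lies on some hyperplane `a_i = s`, so the previous lemma makes each polynomial
factor vanish everywhere. -/
theorem quasiEval_injective (i : Fin n)
    (hχ : Function.Injective fun γ (j : {j // j ≠ i}) => χ γ j) (u : Γ →₀ (Fin n → ℕ) →₀ K)
    (h : quasiEval χ u = 0) : u = 0 := by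
  ext γ J
  refine coeff_eq_zero_of_polyEval (u γ) i (J i + 1) (fun a _ => ?_) J (Nat.lt_succ_self _)
  exact polyEval_eq_zero_of_quasiEval χ i (a i) hχ u (fun b _ => by rw [h]; rfl) γ a rfl

/-- A function on `ℕ^n` all of whose differences are quasi-polynomials of degree less than `k` is a
quasi-polynomial of degree less than `k + 1`. -/
theorem exists_quasiEval_eq (i₀ : Fin n)
    (hχ : Function.Injective fun γ (j : {j // j ≠ i₀}) => χ γ j) (γ₀ : Γ) (hγ₀ : χ γ₀ = 1)
    {k : ℕ} (c : (Fin n → ℕ) → K)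
    (hc : ∀ i, ∃ u : Γ →₀ (Fin n → ℕ) →₀ K, (∀ γ, u γ ∈ degLT K n k) ∧
      ∀ a, c (a + Pi.single i 1) - c a = quasiEval χ u a) :
    ∃ u : Γ →₀ (Fin n → ℕ) →₀ K, (∀ γ, u γ ∈ degLT K n (k + 1)) ∧ c = quasiEval χ u := by
  classical
  choose h hdeg hch using hc
  -- Mixed second differences of `c` agree; uniqueness turns this into an equality of coefficients,
  -- so the equations can be solved one character at a time.
  have compat : ∀ i j, quasiDiff χ j (h i) = quasiDiff χ i (h j) := by
    intro i j
    refine sub_eq_zero.mp (quasiEval_injective χ i₀ hχ _ (funext fun a => ?_))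
    rw [map_sub, Pi.sub_apply, quasiEval_quasiDiff, quasiEval_quasiDiff, ← hch, ← hch, ← hch,
      ← hch, add_right_comm]
    simp only [Pi.zero_apply]
    ring
  have hex : ∀ γ, ∃ g ∈ degLT K n (k + 1), ∀ i, twistDiff (χ γ i) i g = h i γ := fun γ =>
    exists_twistDiff_eq (χ γ) (fun i => h i γ) (fun i => hdeg i γ)
      (fun i j => DFunLike.congr_fun (compat i j) γ)
  choose g hg hgh using hex
  -- The chosen solutions `g γ` need not vanish when all `h i γ` do, so they are cut off to a finite
  -- set of characters.
  set s : Finset Γ := Finset.univ.biUnion fun i => (h i).support with hs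
  set u : Γ →₀ (Fin n → ℕ) →₀ K :=
    Finsupp.onFinset s (fun γ => if γ ∈ s then g γ else 0) (by intro γ; simp; tauto) with hu
  have hud : ∀ γ, u γ ∈ degLT K n (k + 1) := by
    intro γ
    simp only [hu, Finsupp.onFinset_apply]
    split_ifs
    · exact hg γ
    · exact zero_mem _
  have huh : ∀ i, quasiDiff χ i u = h i := by
    intro i
    ext1 γ
    rw [quasiDiff_apply]
    simp only [hu, Finsupp.onFinset_apply]
    split_ifs with hγ
    · exact hgh γ i
    · rw [map_zero, eq_comm, ← Finsupp.notMem_support_iff]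
      exact fun h' => hγ (Finset.mem_biUnion.mpr ⟨i, Finset.mem_univ i, h'⟩)
  have hconst : ∀ a, c a - quasiEval χ u a = c 0 - quasiEval χ u 0 := by
    intro a
    induction a using pi_nat_induction with
    | h0 => rfl
    | h1 a i ih =>
      rw [← ih, sub_eq_sub_iff_sub_eq_sub, hch, ← quasiEval_quasiDiff, huh]
  -- `c` and the solution have equal differences, so they differ by a constant, which is absorbed as
  -- a degree-zero polynomial at the trivial character `χ γ₀`.
  refine ⟨u + Finsupp.single γ₀ (Finsupp.single 0 (c 0 - quasiEval χ u 0)), fun γ => ?_, ?_⟩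
  · refine add_mem (hud γ) ?_
    rw [Finsupp.single_apply]
    split_ifs
    · refine mem_degLT.mpr fun J hJ => ?_
      rw [Finsupp.single_apply, if_neg]
      rintro rfl
      simp at hJ
    · exact zero_mem _
  · ext a
    rw [map_add, Pi.add_apply, quasiEval_single, polyEval_single, multiChoose_zero, hγ₀,
      ← hconst a]
    simp [charFun]

end QuasiPoly

/-! ### Coefficient functions of operators on quantum affine space -/

section BetaEval

variable {K : Type*} [Field K] {n : ℕ} (Q : QMatrix K n)

/-- The values of the characters `β(γ, ·)` on the standard basis. -/
def betaChar (γ : Fin n → ℤ) (j : Fin n) : Kˣ := (natBichar Q).toFun γ (stdVec j)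

theorem charFun_betaChar (γ : Fin n → ℤ) (a : Fin n → ℕ) :
    charFun (betaChar Q γ) a = (((natBichar Q).toFun γ (natVec a) : Kˣ) : K) := by
  rw [charFun, natBichar_eq_prod]; rfl

/-- Quasi-polynomial functions with the characters `β(γ, ·)`. -/
abbrev betaEval : ((Fin n → ℤ) →₀ (Fin n → ℕ) →₀ K) →ₗ[K] ((Fin n → ℕ) → K) :=
  quasiEval (betaChar Q)

/-- The coefficients of quasi-polynomial functions of degree less than `k`. -/
def quasiDegLT (K : Type*) [Field K] (n k : ℕ) :
    Submodule K ((Fin n → ℤ) →₀ (Fin n → ℕ) →₀ K) where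
  carrier := {u | ∀ γ, u γ ∈ degLT K n k}
  add_mem' hu hv γ := add_mem (hu γ) (hv γ)
  zero_mem' _ := zero_mem _
  smul_mem' c _ hu γ := Submodule.smul_mem _ c (hu γ)

theorem single_mem_quasiDegLT {k : ℕ} (γ : Fin n → ℤ) {g : (Fin n → ℕ) →₀ K}
    (hg : g ∈ degLT K n k) : Finsupp.single γ g ∈ quasiDegLT K n k := by
  intro γ'
  rw [Finsupp.single_apply]
  split_ifs
  · exact hg
  · exact zero_mem _

theorem single_mem_degLT {k : ℕ} {J : Fin n → ℕ} (hJ : ∑ i, J i < k) (c : K) :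
    Finsupp.single J c ∈ degLT K n k :=
  Finsupp.single_mem_supported K c hJ

/-- Multiplication of quasi-polynomials by `β(η, ·)`. -/
theorem exists_betaEval_mul {k : ℕ} (η : Fin n → ℤ) {u : (Fin n → ℤ) →₀ (Fin n → ℕ) →₀ K}
    (hu : u ∈ quasiDegLT K n k) : ∃ v ∈ quasiDegLT K n k, ∀ a,
      betaEval Q v a = (((natBichar Q).toFun η (natVec a) : Kˣ) : K) * betaEval Q u a := by
  refine ⟨Finsupp.equivMapDomain (Equiv.addLeft η) u, fun γ => ?_, fun a => ?_⟩
  · rw [Finsupp.equivMapDomain_apply]; exact hu _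
  · clear hu
    rw [Finsupp.equivMapDomain_eq_mapDomain]
    induction u using Finsupp.induction_linear with
    | zero => simp
    | add f g hf hg => rw [Finsupp.mapDomain_add, map_add, map_add, Pi.add_apply, hf, hg,
        Pi.add_apply, mul_add]
    | single γ g =>
      rw [Finsupp.mapDomain_single, quasiEval_single, quasiEval_single, charFun_betaChar,
        charFun_betaChar, Equiv.coe_addLeft, Bicharacter.map_add_left, Units.val_mul, mul_assoc]

/-- Translation of quasi-polynomials. -/
theorem exists_betaEval_add_single {k : ℕ} (i : Fin n) {u : (Fin n → ℤ) →₀ (Fin n → ℕ) →₀ K}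
    (hu : u ∈ quasiDegLT K n k) : ∃ v ∈ quasiDegLT K n k, ∀ a,
      betaEval Q v a = betaEval Q u (a + Pi.single i 1) := by
  refine ⟨u + quasiDiff (betaChar Q) i u,
    add_mem hu fun γ => twistDiff_mem_degLT _ _ (hu γ), fun a => ?_⟩
  rw [map_add, Pi.add_apply, quasiEval_quasiDiff, add_sub_cancel]

end BetaEval

section Coeffs

variable {K : Type*} [Field K] [CharZero K] {n : ℕ} (Q : QMatrix K n)

/-- The coordinate of degree `z ∈ ℤ^n` with respect to the basis of monomials. -/
def coordZ (z : Fin n → ℤ) : QSpace Q →ₗ[K] K :=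
  (monomBasis Q).constr K fun b => if natVec b = z then 1 else 0

theorem coordZ_monom (z : Fin n → ℤ) (b : Fin n → ℕ) :
    coordZ Q z (monom Q b) = if natVec b = z then 1 else 0 := by
  rw [coordZ, ← monomBasis_apply, Module.Basis.constr_basis]

theorem ext_coordZ {r s : QSpace Q} (h : ∀ z, coordZ Q z r = coordZ Q z s) : r = s := by
  have hc : ∀ b, coordZ Q (natVec b) = (monomBasis Q).coord b := by
    intro b
    refine (monomBasis Q).ext fun a => ?_
    rw [monomBasis_apply, coordZ_monom, ← monomBasis_apply, Module.Basis.coord_apply,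
      Module.Basis.repr_self, Finsupp.single_apply]
    simp only [natVec_injective.eq_iff]
  refine (monomBasis Q).ext_elem fun b => ?_
  have := h (natVec b)
  rwa [hc] at this

theorem coordZ_eq_zero_of_neg {z : Fin n → ℤ} {i : Fin n} (hz : z i < 0) : coordZ Q z = 0 := by
  refine (monomBasis Q).ext fun a => ?_
  rw [monomBasis_apply, coordZ_monom, if_neg]
  · rfl
  · rintro rfl
    simp [natVec] at hz
    omega

theorem coordZ_lam_x (i : Fin n) (z : Fin n → ℤ) (r : QSpace Q) :
    coordZ Q (z + stdVec i) ((lam (QSpace.x Q i) : Module.End K (QSpace Q)) r) =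
      (((natBichar Q).toFun (stdVec i) z * (ordBichar Q).toFun (stdVec i) z : Kˣ) : K) *
        coordZ Q z r := by
  refine LinearMap.congr_fun (f := coordZ Q (z + stdVec i) ∘ₗ lam (QSpace.x Q i))
    (g := (((natBichar Q).toFun (stdVec i) z * (ordBichar Q).toFun (stdVec i) z : Kˣ) : K) •
      coordZ Q z) ?_ r
  refine (monomBasis Q).ext fun a => ?_
  rw [monomBasis_apply, LinearMap.comp_apply, lam_monom, map_smul, LinearMap.smul_apply,
    coordZ_monom, coordZ_monom, natVec_add_single]
  simp only [add_left_inj]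
  split_ifs with h
  · rw [h]
  · simp

/-- The grading is spanned by words, and each word is a scalar multiple of the monomial of the same
degree. -/
theorem coordZ_eq_zero_of_mem {d z : Fin n → ℤ} (h : d ≠ z) {r : QSpace Q} (hr : r ∈ grading Q d) :
    coordZ Q z r = 0 := by
  have hw : ∀ l : List (Fin n), ∃ (k : K) (a : Fin n → ℕ),
      (l.map (QSpace.x Q)).prod = k • monom Q a ∧ natVec a = (l.map stdVec).sum := by
    intro l
    induction l with
    | nil => exact ⟨1, 0, by simp [monom_zero], by simp [natVec_zero]⟩
    | cons i l ih =>
      obtain ⟨k, a, h1, h2⟩ := ih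
      have h3 := lam_monom Q i a
      refine ⟨k * (((natBichar Q).toFun (stdVec i) (natVec a) *
        (ordBichar Q).toFun (stdVec i) (natVec a) : Kˣ) : K), a + Pi.single i 1, ?_, by
        rw [natVec_add_single, h2, List.map_cons, List.sum_cons, add_comm]⟩
      rw [List.map_cons, List.prod_cons, h1, mul_smul_comm]
      exact (congrArg (k • ·) h3).trans (smul_smul _ _ _)
  have : grading Q d ≤ LinearMap.ker (coordZ Q z) := by
    refine Submodule.span_le.mpr ?_
    rintro _ ⟨l, rfl, rfl⟩
    obtain ⟨k, a, h1, h2⟩ := hw l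
    rw [SetLike.mem_coe, LinearMap.mem_ker, h1, map_smul, coordZ_monom, if_neg (h2 ▸ h), smul_zero]
  exact this hr

/-- The coefficient functions of an operator: `coeffs φ z a` is the coefficient in degree `a + z`
of `φ` applied to the monomial of degree `a`, normalized by `ω(z, a)`. -/
def coeffs : Module.End K (QSpace Q) →ₗ[K] ((Fin n → ℤ) → (Fin n → ℕ) → K) :=
  LinearMap.pi fun z => LinearMap.pi fun a =>
    ((((ordBichar Q).toFun z (natVec a))⁻¹ : Kˣ) : K) •
      (coordZ Q (natVec a + z) ∘ₗ LinearMap.applyₗ (monom Q a))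

theorem coeffs_apply (φ : Module.End K (QSpace Q)) (z : Fin n → ℤ) (a : Fin n → ℕ) :
    coeffs Q φ z a = ((((ordBichar Q).toFun z (natVec a))⁻¹ : Kˣ) : K) *
      coordZ Q (natVec a + z) (φ (monom Q a)) := rfl

theorem coeffs_injective : Function.Injective (coeffs Q) := by
  intro φ ψ h
  refine (monomBasis Q).ext fun a => ext_coordZ Q fun z => ?_
  have := congrFun (congrFun h (z - natVec a)) a
  rw [coeffs_apply, coeffs_apply, add_sub_cancel] at this
  rw [monomBasis_apply]
  exact mul_left_cancel₀ (Units.ne_zero _) this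

/-- The only constraint on coefficient functions: there are no monomials of degree outside `ℕ^n`. -/
theorem coeffs_eq_zero_of_neg (φ : Module.End K (QSpace Q)) {z : Fin n → ℤ} {a : Fin n → ℕ}
    {i : Fin n} (h : a i + z i < 0) : coeffs Q φ z a = 0 := by
  rw [coeffs_apply, coordZ_eq_zero_of_neg Q (i := i) (by simpa [natVec] using h),
    LinearMap.zero_apply, mul_zero]

theorem coeffs_of_homogeneous {φ : Module.End K (QSpace Q)} {d : Fin n → ℤ}
    (hφ : IsHomogeneousOfDegree (grading Q) φ d) : coeffs Q φ = Pi.single d (coeffs Q φ d) := by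
  ext z a
  by_cases h : z = d
  · subst h; simp
  · rw [Pi.single_eq_of_ne h, coeffs_apply,
      coordZ_eq_zero_of_mem Q (d := d + natVec a) ?_ (hφ _ _ (monom_mem Q a)), mul_zero]
    · rfl
    · rw [add_comm]
      exact fun h' => h (add_left_cancel h').symm

/-- Together with `coeffs_lam_x_mul` this justifies the normalization by `ω`: right and left
composition with `λ_{x_i}` carry identical factors and differ only by the translation of `a`, so the
commutator is a difference. -/
theorem coeffs_mul_lam_x (φ : Module.End K (QSpace Q)) (i : Fin n) (z : Fin n → ℤ)
    (a : Fin n → ℕ) :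
    coeffs Q (φ * lam (QSpace.x Q i)) (z + stdVec i) a =
      (((ordBichar Q).toFun z (stdVec i) : Kˣ) : K) *
        ((((natBichar Q).toFun (stdVec i) (natVec a) : Kˣ) : K) *
          coeffs Q φ z (a + Pi.single i 1)) := by
  rw [coeffs_apply, coeffs_apply, Module.End.mul_apply, lam_monom, map_smul, map_smul,
    natVec_add_single, Bicharacter.map_add_left, Bicharacter.map_add_right, smul_eq_mul,
    add_right_comm (natVec a), add_assoc]
  simp only [mul_inv, Units.val_mul, Units.val_inv_eq_inv_val]
  field_simp

theorem coeffs_lam_x_mul (φ : Module.End K (QSpace Q)) (i : Fin n) (z : Fin n → ℤ)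
    (a : Fin n → ℕ) :
    coeffs Q (lam (QSpace.x Q i) * φ) (z + stdVec i) a =
      (((ordBichar Q).toFun z (stdVec i) : Kˣ) : K) *
        ((((natBichar Q).toFun (stdVec i) (natVec a) : Kˣ) : K) * coeffs Q φ z a) := by
  rw [coeffs_apply, coeffs_apply, Module.End.mul_apply, ← add_assoc, coordZ_lam_x,
    Bicharacter.map_add_left, Bicharacter.map_add_right, Bicharacter.map_add_right,
    natBichar_eq Q (stdVec i) z]
  simp only [mul_inv, Units.val_mul, Units.val_inv_eq_inv_val]
  field_simp

/-- The `a`-dependent values of `ω` coming from `ρ_I` and `δ_J` cancel against the normalization,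
leaving only `ω(I - J, J)⁻¹`. The constant is independent of `γ`, which enters through its character
alone. -/
theorem exists_coeffs_gen (I J : Fin n → ℕ) : ∃ k : K, k ≠ 0 ∧ ∀ γ,
    coeffs Q (rhoPow Q I * deltaPow Q J * sig Q γ) = Pi.single (natVec I - natVec J)
      (betaEval Q (Finsupp.single γ (Finsupp.single J k))) := by
  obtain ⟨k, hk, h⟩ := exists_deltaPow_monom Q J
  refine ⟨k * ((((ordBichar Q).toFun (natVec I - natVec J) (natVec J))⁻¹ : Kˣ) : K),
    mul_ne_zero hk (Units.ne_zero _), fun γ => ?_⟩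
  ext z a
  rw [coeffs_apply, Module.End.mul_apply, Module.End.mul_apply, sig_monom, map_smul, map_smul, map_smul]
  by_cases hJ : J ≤ a
  · obtain ⟨b, rfl⟩ : ∃ b, a = b + J := ⟨a - J, (tsub_add_cancel_of_le hJ).symm⟩
    rw [h, map_smul, rhoPow_monom, map_smul, map_smul, coordZ_monom]
    by_cases hz : z = natVec I - natVec J
    · subst hz
      rw [if_pos (by rw [natVec_add, natVec_add]; abel), Pi.single_eq_same, quasiEval_single,
        polyEval_single, charFun_betaChar]
      simp only [natVec_add, Bicharacter.map_add_right, sub_eq_add_neg,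
        Bicharacter.map_add_left, toFun_neg_left, smul_eq_mul, mul_inv, Units.val_mul, mul_one,
        inv_inv, Units.val_inv_eq_inv_val]
      have h1 := Units.ne_zero ((ordBichar Q).toFun (natVec I) (natVec b))
      have h2 := Units.ne_zero ((ordBichar Q).toFun (natVec I) (natVec J))
      have h3 := Units.ne_zero ((ordBichar Q).toFun (natVec J) (natVec J))
      have h4 := Units.ne_zero ((ordBichar Q).toFun (natVec J) (natVec b))
      field_simp
    · rw [if_neg, Pi.single_eq_of_ne hz]
      · simp
      · intro h'
        rw [natVec_add, natVec_add, add_assoc] at h'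
        exact hz (eq_sub_of_add_eq' (add_left_cancel h').symm)
  · rw [deltaPow_monom_eq_zero Q J a hJ]
    by_cases hz : z = natVec I - natVec J
    · subst hz
      rw [Pi.single_eq_same, quasiEval_single, polyEval_single, multiChoose_eq_zero hJ]
      simp
    · rw [Pi.single_eq_of_ne hz]
      simp

/-! ### From quasi-polynomial coefficient functions back to operators. -/

/-- The span of the operators `ρ_I δ_J σ_γ` with `|J| < k`. -/
def opFil (k : ℕ) : Submodule K (Module.End K (QSpace Q)) :=
  Submodule.span K {φ | ∃ (I J : Fin n → ℕ) (γ : Fin n → ℤ), ∑ i, J i < k ∧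
    φ = rhoPow Q I * deltaPow Q J * sig Q γ}

theorem exists_betaEval_of_mem_opFil {k : ℕ} {φ : Module.End K (QSpace Q)} (hφ : φ ∈ opFil Q k)
    (z : Fin n → ℤ) : ∃ u ∈ quasiDegLT K n k, coeffs Q φ z = betaEval Q u := by
  have : opFil Q k ≤ ((quasiDegLT K n k).map (betaEval Q)).comap
      (LinearMap.proj z ∘ₗ coeffs Q) := by
    refine Submodule.span_le.mpr ?_
    rintro _ ⟨I, J, γ, hJ, rfl⟩
    obtain ⟨c, -, hc⟩ := exists_coeffs_gen Q I J
    rw [SetLike.mem_coe, Submodule.mem_comap, LinearMap.comp_apply, hc, LinearMap.proj_apply]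
    by_cases hz : z = natVec I - natVec J
    · subst hz
      rw [Pi.single_eq_same]
      exact Submodule.mem_map_of_mem (single_mem_quasiDegLT γ (single_mem_degLT hJ c))
    · rw [Pi.single_eq_of_ne hz]
      exact zero_mem _
  obtain ⟨u, hu, h⟩ := this hφ
  exact ⟨u, hu, h.symm⟩

/-- A term `β(γ, a) binom(a, J)` in degree `d` comes from `ρ_{J+d} δ_J σ_γ` as soon as `J + d ≥ 0`.
Genericity on every hyperplane `a_i = s` ensures this inequality. -/
theorem mem_opFil_of_coeffs
    (hχ : ∀ i, Function.Injective fun γ (j : {j // j ≠ i}) => betaChar Q γ j.1)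
    {k : ℕ} {φ : Module.End K (QSpace Q)} {d : Fin n → ℤ}
    {u : (Fin n → ℤ) →₀ (Fin n → ℕ) →₀ K} (hu : u ∈ quasiDegLT K n k)
    (hφ : coeffs Q φ = Pi.single d (betaEval Q u)) : φ ∈ opFil Q k := by
  have hpos : ∀ γ J, u γ J ≠ 0 → ∀ i, 0 ≤ (J i : ℤ) + d i := by
    intro γ J hJ i
    by_contra! hneg
    -- The function vanishes for `a_i < -d_i`, so on each such hyperplane every polynomial factor
    -- vanishes, and `binom(a, J)` with `J_i < -d_i` cannot occur.
    refine hJ (coeff_eq_zero_of_polyEval (u γ) i (-d i).toNat (fun a ha => ?_) J (by omega))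
    refine polyEval_eq_zero_of_quasiEval (betaChar Q) i (a i) (hχ i) u (fun b hb => ?_) γ a rfl
    have h1 := congrFun (congrFun hφ d) b
    rw [Pi.single_eq_same] at h1
    rw [← h1]
    exact coeffs_eq_zero_of_neg Q φ (i := i) (by omega)
  -- `S` consists of the quasi-polynomials that, placed in degree `d`, are realized in `opFil Q k`.
  -- It is a subspace, so single terms suffice.
  set S := ((opFil Q k).map (coeffs Q)).comap
    (LinearMap.single K (fun _ : Fin n → ℤ => (Fin n → ℕ) → K) d ∘ₗ betaEval Q) with hS
  have hmem : u ∈ S := by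
    rw [← u.sum_single]
    refine Submodule.sum_mem _ fun γ _ => ?_
    rw [← (u γ).sum_single, Finsupp.single_sum]
    refine Submodule.sum_mem _ fun J hJ => ?_
    rw [Finsupp.mem_support_iff] at hJ
    have hp := hpos γ J hJ
    set I : Fin n → ℕ := fun i => (J i + d i).toNat with hI
    obtain ⟨c, hc, h⟩ := exists_coeffs_gen Q I J
    have hd : natVec I - natVec J = d := by
      ext i
      simp only [natVec, hI, Pi.sub_apply]
      have := hp i
      omega
    have hJk : ∑ i, J i < k := by
      by_contra! hk
      exact hJ (mem_degLT.mp (hu γ) J hk)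
    refine ⟨(u γ J * c⁻¹) • (rhoPow Q I * deltaPow Q J * sig Q γ),
      Submodule.smul_mem _ _ (Submodule.subset_span ⟨I, J, γ, hJk, rfl⟩), ?_⟩
    rw [map_smul, h, hd, LinearMap.comp_apply, LinearMap.single_apply, ← Pi.single_smul,
      ← map_smul, Finsupp.smul_single, Finsupp.smul_single, smul_eq_mul, mul_assoc,
      inv_mul_cancel₀ hc, mul_one]
  obtain ⟨ψ, hψ, h⟩ := hmem
  rw [LinearMap.comp_apply, LinearMap.single_apply, ← hφ] at h
  exact coeffs_injective Q h ▸ hψ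

end Coeffs

/-! ### Generic parameters -/

section Generic

theorem betaChar_eq_prod {K : Type*} [Field K] {n : ℕ} (Q : QMatrix K n) (γ : Fin n → ℤ)
    (j : Fin n) :
    betaChar Q γ j = ∏ k, Q.q k j ^ γ k := by
  simp only [betaChar, natBichar, stdVec]
  refine Finset.prod_congr rfl fun k _ => ?_
  rw [Finset.prod_eq_single j]
  · simp
  · intro l _ hl; simp [hl]
  · simp

variable {K : Type*} [Field K] [CharZero K] {n : ℕ}

/-- Moving negative exponents to the other side gives two monomials with the same value; algebraic
independence makes them the same monomial, so the positive and negative parts of `z` agree and both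
vanish. -/
theorem eq_zero_of_prod_zpow_eq_one {ι : Type*} [Fintype ι] (t : ι → Kˣ)
    (ht : AlgebraicIndependent ℚ fun i => (t i : K)) (z : ι → ℤ) (h : ∏ i, t i ^ z i = 1) :
    z = 0 := by
  have h1 : ∏ i, t i ^ (z i).toNat = ∏ i, t i ^ (-z i).toNat := by
    rw [← div_eq_one, ← Finset.prod_div_distrib, ← h]
    refine Finset.prod_congr rfl fun i _ => ?_
    rw [← zpow_natCast, ← zpow_natCast, div_eq_mul_inv, ← zpow_sub]
    congr 1
    omega
  have h2 : ∀ s : ι → ℕ, MvPolynomial.aeval (fun i => (t i : K))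
      (MvPolynomial.monomial (Finsupp.equivFunOnFinite.symm s) (1 : ℚ)) =
        ((∏ i, t i ^ s i : Kˣ) : K) := by
    intro s
    rw [MvPolynomial.aeval_monomial, map_one, one_mul, Finsupp.prod_fintype _ _ (by simp)]
    simp
  have h3 := (h2 fun i => (z i).toNat).trans ((congrArg Units.val h1).trans
    (h2 fun i => (-z i).toNat).symm)
  have h4 := Finsupp.equivFunOnFinite.symm.injective
    (MvPolynomial.monomial_left_injective one_ne_zero (ht h3))
  ext i
  have := congrFun h4 i
  simp only [Pi.zero_apply] at this ⊢
  omega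

variable {Q : QMatrix K n}

/-- In `∏ k, q_{kj}^{γ_k}` the factor `k = j` is trivial, so `γ_j` is invisible; the others are
distinct independent parameters up to inversion. -/
theorem eq_zero_of_betaChar_eq_one
    (hQ : AlgebraicIndependent ℚ
      (fun p : {p : Fin n × Fin n // p.1 < p.2} => ((Q.q p.1.1 p.1.2 : Kˣ) : K)))
    (γ : Fin n → ℤ) (j : Fin n) (h : betaChar Q γ j = 1) (k : Fin n) (hk : k ≠ j) : γ k = 0 := by
  -- `e` sorts the pair `{k, j}`; when `k > j` the parameter is inverted, whence the sign of `γ k`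
  -- below.
  set e : {k // k ≠ j} → {p : Fin n × Fin n // p.1 < p.2} := fun k =>
    if h : k.1 < j then ⟨(k.1, j), h⟩ else ⟨(j, k.1), lt_of_le_of_ne (not_lt.mp h) k.2.symm⟩ with he
  have hinj : Function.Injective e := by
    rintro ⟨k, hk⟩ ⟨l, hl⟩ hkl
    simp only [he] at hkl
    split_ifs at hkl <;> simp_all
  have hz := eq_zero_of_prod_zpow_eq_one
    (fun k : {k // k ≠ j} => Q.q (e k).1.1 (e k).1.2) (hQ.comp e hinj)
    (fun k => if k.1 < j then γ k else -γ k) ?_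
  · have := congrFun hz ⟨k, hk⟩
    simp only [Pi.zero_apply] at this
    split_ifs at this <;> omega
  · rw [← h, betaChar_eq_prod, Fintype.prod_eq_mul_prod_subtype_ne _ j, Q.q_self, one_zpow, one_mul]
    refine Finset.prod_congr rfl fun k _ => ?_
    simp only [he]
    split_ifs with hkj
    · rfl
    · rw [Q.q_swap j k, inv_zpow']

/-- The value at `e_j` determines all coordinates of `γ` but the `j`-th. To recover `γ_k` without
using `e_i`, an index `j` outside `{i, k}` is needed, and `n ≥ 3` provides it. -/
theorem betaChar_injective (hn : 3 ≤ n)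
    (hQ : AlgebraicIndependent ℚ
      (fun p : {p : Fin n × Fin n // p.1 < p.2} => ((Q.q p.1.1 p.1.2 : Kˣ) : K))) (i : Fin n) :
    Function.Injective fun γ (j : {j // j ≠ i}) => betaChar Q γ j.1 := by
  intro γ γ' h
  refine sub_eq_zero.mp (funext fun k => ?_)
  obtain ⟨j, hj⟩ : ∃ j, j ∉ ({i, k} : Finset (Fin n)) := by
    by_contra! hall
    have h1 : Finset.univ ⊆ ({i, k} : Finset (Fin n)) := fun j _ => hall j
    have h2 := (Finset.card_le_card h1).trans Finset.card_le_two
    simp at h2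
    omega
  simp only [Finset.mem_insert, Finset.mem_singleton, not_or] at hj
  refine eq_zero_of_betaChar_eq_one hQ (γ - γ') j ?_ k (Ne.symm hj.2)
  have h' : betaChar Q γ j = betaChar Q γ' j := congrFun h ⟨j, hj.1⟩
  rw [betaChar, sub_eq_add_neg, Bicharacter.map_add_left, toFun_neg_left]
  exact mul_inv_eq_one.mpr h'

end Generic

/-! ### The filtration of `D_q(R)` -/

section DqFiltration

variable {K : Type*} [Field K] {n : ℕ} (Q : QMatrix K n)

theorem sig_homogeneous (a : Fin n → ℤ) : IsHomogeneousOfDegree (grading Q) (sig Q a) 0 := by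
  intro e r hr
  rw [zero_add, sigma_of_mem _ _ _ hr]
  exact Submodule.smul_mem _ _ hr

theorem qcomm_sig (a : Fin n → ℤ) (r : QSpace Q) :
    qcomm (grading Q) (natBichar Q) a (sig Q a) r = 0 := by
  refine sub_eq_zero.mpr (LinearMap.ext fun s => ?_)
  exact sigma_map_mul _ _ a r s

theorem sig_mem_DqOrder (a : Fin n → ℤ) : sig Q a ∈ DqOrder (grading Q) (natBichar Q) 0 :=
  subset_bimoduleSpan ⟨⟨0, sig_homogeneous Q a⟩, a, fun r => by rw [qcomm_sig]; exact zero_mem _⟩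

theorem rhoX_mem_DqOrder (i : Fin n) : rhoX Q i ∈ DqOrder (grading Q) (natBichar Q) 0 := by
  refine subset_bimoduleSpan ⟨⟨_, rho_homogeneous _ (x_mem_grading Q i)⟩, 0, fun r => ?_⟩
  have : qcomm (grading Q) (natBichar Q) 0 (rhoX Q i) r = 0 := by
    rw [qcomm, sigma_zero]
    refine sub_eq_zero.mpr (LinearMap.ext fun s => ?_)
    exact mul_assoc r s (QSpace.x Q i)
  rw [this]
  exact zero_mem _

/-- The skew Leibniz rule reads `[δ_i, r]_0 = λ_{δ_i(r)} σ_{e_i}`, which has order zero. -/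
theorem delta_mem_DqOrder (i : Fin n) : delta Q i ∈ DqOrder (grading Q) (natBichar Q) 1 := by
  refine subset_bimoduleSpan ⟨⟨_, delta_homogeneous Q i⟩, 0, fun r => ?_⟩
  have : qcomm (grading Q) (natBichar Q) 0 (delta Q i) r =
      lam (delta Q i r) * sig Q (stdVec i) := by
    rw [qcomm, sigma_zero, sub_eq_iff_eq_add]
    refine LinearMap.ext fun s => ?_
    exact delta_mul Q i r s
  rw [this]
  exact lam_mul_mem (sig_mem_DqOrder Q _) _

theorem rhoPow_mem_DqOrder (I : Fin n → ℕ) :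
    rhoPow Q I ∈ DqOrder (grading Q) (natBichar Q) 0 := by
  induction I using pi_nat_induction with
  | h0 => rw [rhoPow_zero]; exact one_mem_DqOrder_zero _ _
  | h1 I i ih =>
    rw [rhoPow_add_single]
    exact Submodule.smul_mem _ _ (DqOrder_mul _ _ (i := 0) (j := 0) (rhoX_mem_DqOrder Q i) ih)

theorem deltaPow_mem_DqOrder (J : Fin n → ℕ) :
    deltaPow Q J ∈ DqOrder (grading Q) (natBichar Q) (∑ i, J i) := by
  induction J using pi_nat_induction with
  | h0 => rw [deltaPow_zero]; simpa using one_mem_DqOrder_zero _ _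
  | h1 J i ih =>
    obtain ⟨k, hk⟩ := exists_deltaPow_add_single Q i J
    rw [hk, sum_add_single, add_comm]
    exact Submodule.smul_mem _ _ (DqOrder_mul _ _ (delta_mem_DqOrder Q i) ih)

theorem opFil_le_DqBelow (k : ℕ) : opFil Q k ≤ DqBelow (grading Q) (natBichar Q) k := by
  refine Submodule.span_le.mpr ?_
  rintro _ ⟨I, J, γ, hJ, rfl⟩
  cases k with
  | zero => exact absurd hJ (Nat.not_lt_zero _)
  | succ k =>
    have h := DqOrder_mul _ _ (DqOrder_mul _ _ (rhoPow_mem_DqOrder Q I) (deltaPow_mem_DqOrder Q J))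
      (sig_mem_DqOrder Q γ)
    exact DqOrder_mono _ _ (by omega) h

theorem mul_sig_mem_opFil {k : ℕ} {φ : Module.End K (QSpace Q)} (hφ : φ ∈ opFil Q k)
    (η : Fin n → ℤ) : φ * sig Q η ∈ opFil Q k := by
  have : opFil Q k ≤ (opFil Q k).comap (LinearMap.mulRight K (sig Q η)) := by
    refine Submodule.span_le.mpr ?_
    rintro _ ⟨I, J, γ, hJ, rfl⟩
    have h : sig Q γ * sig Q η = sig Q (γ + η) := sigma_mul _ _ γ η
    rw [SetLike.mem_coe, Submodule.mem_comap, LinearMap.mulRight_apply, mul_assoc, h]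
    exact Submodule.subset_span ⟨I, J, γ + η, hJ, rfl⟩
  exact this hφ

theorem eq_single_of_add_stdVec {c : (Fin n → ℤ) → (Fin n → ℕ) → K} {d : Fin n → ℤ} (i : Fin n)
    {f : (Fin n → ℕ) → K} (h : ∀ z a, c (z + stdVec i) a = if z = d then f a else 0) :
    c = Pi.single (d + stdVec i) f := by
  ext z a
  obtain ⟨z, rfl⟩ : ∃ w, z = w + stdVec i := ⟨z - stdVec i, by simp⟩
  rw [h]
  by_cases hz : z = d
  · subst hz; simp
  · rw [if_neg hz, Pi.single_eq_of_ne (by simpa using hz)]; rfl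

variable [CharZero K]

/-- Left multiplication by `x_i` multiplies coefficient functions by a constant and the character
`β(e_i, ·)`, and right multiplication in the next lemma also translates them; neither raises the
degree. This makes `opFil` an `R`-subbimodule. -/
theorem lam_x_mul_mem_opFil
    (hχ : ∀ i, Function.Injective fun γ (j : {j // j ≠ i}) => betaChar Q γ j.1)
    {k : ℕ} {φ : Module.End K (QSpace Q)} (hφ : φ ∈ opFil Q k)
    (i : Fin n) : lam (QSpace.x Q i) * φ ∈ opFil Q k := by
  have : opFil Q k ≤ (opFil Q k).comap (LinearMap.mulLeft K (lam (QSpace.x Q i))) := by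
    refine Submodule.span_le.mpr ?_
    rintro _ ⟨I, J, γ, hJ, rfl⟩
    obtain ⟨c, -, hc⟩ := exists_coeffs_gen Q I J
    obtain ⟨v, hv, hvu⟩ := exists_betaEval_mul Q (stdVec i)
      (single_mem_quasiDegLT γ (single_mem_degLT hJ c))
    set d := natVec I - natVec J with hd
    refine mem_opFil_of_coeffs Q hχ (d := d + stdVec i)
      (u := (((ordBichar Q).toFun d (stdVec i) : Kˣ) : K) • v) (Submodule.smul_mem _ _ hv)
      (eq_single_of_add_stdVec i fun z a => ?_)
    rw [LinearMap.mulLeft_apply, coeffs_lam_x_mul, hc, map_smul, Pi.smul_apply, hvu, smul_eq_mul]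
    split_ifs with hz
    · subst hz; rw [Pi.single_eq_same]
    · rw [Pi.single_eq_of_ne hz]; simp
  exact this hφ

theorem mul_lam_x_mem_opFil
    (hχ : ∀ i, Function.Injective fun γ (j : {j // j ≠ i}) => betaChar Q γ j.1)
    {k : ℕ} {φ : Module.End K (QSpace Q)} (hφ : φ ∈ opFil Q k)
    (i : Fin n) : φ * lam (QSpace.x Q i) ∈ opFil Q k := by
  have : opFil Q k ≤ (opFil Q k).comap (LinearMap.mulRight K (lam (QSpace.x Q i))) := by
    refine Submodule.span_le.mpr ?_
    rintro _ ⟨I, J, γ, hJ, rfl⟩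
    obtain ⟨c, -, hc⟩ := exists_coeffs_gen Q I J
    obtain ⟨w, hw, hwu⟩ := exists_betaEval_add_single Q i
      (single_mem_quasiDegLT γ (single_mem_degLT hJ c))
    obtain ⟨v, hv, hvu⟩ := exists_betaEval_mul Q (stdVec i) hw
    set d := natVec I - natVec J with hd
    refine mem_opFil_of_coeffs Q hχ (d := d + stdVec i)
      (u := (((ordBichar Q).toFun d (stdVec i) : Kˣ) : K) • v) (Submodule.smul_mem _ _ hv)
      (eq_single_of_add_stdVec i fun z a => ?_)
    rw [LinearMap.mulRight_apply, coeffs_mul_lam_x, hc, map_smul, Pi.smul_apply, hvu, hwu,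
      smul_eq_mul]
    split_ifs with hz
    · subst hz; rw [Pi.single_eq_same]
    · rw [Pi.single_eq_of_ne hz]; simp
  exact this hφ

theorem lam_mul_mem_opFil
    (hχ : ∀ i, Function.Injective fun γ (j : {j // j ≠ i}) => betaChar Q γ j.1)
    {k : ℕ} (r : QSpace Q) : ∀ {φ : Module.End K (QSpace Q)},
    φ ∈ opFil Q k → lam r * φ ∈ opFil Q k ∧ φ * lam r ∈ opFil Q k := by
  induction r using QSpace.induction with
  | halg c =>
    intro φ hφ
    have : (lam (algebraMap K (QSpace Q) c) : Module.End K (QSpace Q)) = c • 1 := by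
      ext s; simp [lam, Algebra.smul_def]
    rw [this, smul_one_mul, mul_smul_one]
    exact ⟨Submodule.smul_mem _ c hφ, Submodule.smul_mem _ c hφ⟩
  | hx i => exact fun hφ => ⟨lam_x_mul_mem_opFil Q hχ hφ i, mul_lam_x_mem_opFil Q hχ hφ i⟩
  | hmul r s hr hs =>
    intro φ hφ
    rw [lam_mul, mul_assoc, ← mul_assoc]
    exact ⟨(hr (hs hφ).1).1, (hs (hr hφ).2).2⟩
  | hadd r s hr hs =>
    intro φ hφ
    have : (lam (r + s) : Module.End K (QSpace Q)) = lam r + lam s := by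
      ext t; simp [lam, add_mul]
    rw [this, add_mul, mul_add]
    exact ⟨add_mem (hr hφ).1 (hs hφ).1, add_mem (hr hφ).2 (hs hφ).2⟩

/-- The integration theorem in operator form: dividing the commutator's function by `β(e_i, ·)` and
a constant leaves the difference of the coefficient function of `φ`. -/
theorem mem_opFil_succ_of_commutator
    (hχ : ∀ i, Function.Injective fun γ (j : {j // j ≠ i}) => betaChar Q γ j.1)
    (hn : 0 < n) {k : ℕ} {φ : Module.End K (QSpace Q)}
    {d : Fin n → ℤ} (hφ : IsHomogeneousOfDegree (grading Q) φ d)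
    (h : ∀ i, φ * lam (QSpace.x Q i) - lam (QSpace.x Q i) * φ ∈ opFil Q k) :
    φ ∈ opFil Q (k + 1) := by
  obtain ⟨u, hu, huc⟩ := exists_quasiEval_eq (betaChar Q) ⟨0, hn⟩ (hχ _) 0
    (funext fun j => toFun_zero_left _ _) (k := k) (coeffs Q φ d) (fun i => by
      obtain ⟨v, hv, hvc⟩ := exists_betaEval_of_mem_opFil Q (h i) (d + stdVec i)
      obtain ⟨w, hw, hwv⟩ := exists_betaEval_mul Q (-stdVec i) hv
      refine ⟨((((ordBichar Q).toFun d (stdVec i))⁻¹ : Kˣ) : K) • w, Submodule.smul_mem _ _ hw,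
        fun a => ?_⟩
      have h1 := congrFun hvc a
      rw [map_sub, Pi.sub_apply, Pi.sub_apply, coeffs_mul_lam_x, coeffs_lam_x_mul] at h1
      rw [map_smul, Pi.smul_apply, hwv, ← h1, smul_eq_mul, toFun_neg_left]
      simp only [Units.val_inv_eq_inv_val]
      field_simp)
  exact mem_opFil_of_coeffs Q hχ hu ((coeffs_of_homogeneous Q hφ).trans (by rw [huc]))

theorem stepGens_opFil_subset
    (hχ : ∀ i, Function.Injective fun γ (j : {j // j ≠ i}) => betaChar Q γ j.1)
    (hn : 0 < n) (k : ℕ) :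
    stepGens (grading Q) (natBichar Q) (opFil Q k) ⊆ opFil Q (k + 1) := by
  rintro φ ⟨⟨d, hd⟩, a, ha⟩
  -- Untwisting: `[φ σ_{-a}, r]_0 = [φ, σ_{-a}(r)]_a σ_{-a}`, because `σ_{-a}` has zero twisted
  -- commutator with parameter `-a`.
  have h : φ * sig Q (-a) ∈ opFil Q (k + 1) := by
    refine mem_opFil_succ_of_commutator Q hχ hn (d := d + 0)
      (mul_homogeneous _ hd (sig_homogeneous Q (-a))) fun i => ?_
    have h1 := qcomm_mul (grading Q) (natBichar Q) a (-a) φ (sig Q (-a)) (QSpace.x Q i)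
    rw [qcomm_sig, mul_zero, zero_add, add_neg_cancel, qcomm, sigma_zero] at h1
    exact h1 ▸ mul_sig_mem_opFil Q (ha _) (-a)
  have h2 := mul_sig_mem_opFil Q h a
  rwa [mul_assoc, sig, sig, sigma_neg_mul_sigma, mul_one] at h2

theorem DqBelow_eq_opFil
    (hχ : ∀ i, Function.Injective fun γ (j : {j // j ≠ i}) => betaChar Q γ j.1)
    (hn : 0 < n) (k : ℕ) :
    DqBelow (grading Q) (natBichar Q) k = opFil Q k := by
  refine le_antisymm ?_ (opFil_le_DqBelow Q k)
  induction k with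
  | zero => exact bot_le
  | succ k ih =>
    rw [DqBelow_succ]
    refine Submodule.span_le.mpr ?_
    rintro _ ⟨r, s, ψ, hψ, rfl⟩
    have h := stepGens_opFil_subset Q hχ hn k (stepGens_mono _ _ ih hψ)
    exact (lam_mul_mem_opFil Q hχ s (lam_mul_mem_opFil Q hχ r h).1).2

end DqFiltration

/-! ### The skew group algebra -/

section Skew

variable {K : Type*} [Field K] {n : ℕ} (Q : QMatrix K n)

theorem rhoPow_mem (I : Fin n → ℕ) : rhoPow Q I ∈ Delta Q :=
  list_prod_mem fun φ hφ => by
    obtain ⟨i, rfl⟩ := (List.mem_ofFn' _ _).mp hφ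
    exact pow_mem (rhoX_mem Q i) _

theorem deltaPow_mem (J : Fin n → ℕ) : deltaPow Q J ∈ Delta Q :=
  list_prod_mem fun φ hφ => by
    obtain ⟨i, rfl⟩ := (List.mem_ofFn' _ _).mp hφ
    exact pow_mem (delta_mem Q i) _

/-! ### Normal ordering in `Δ` and the map to `D_q(R)`. -/

/-- The span of the operators `ρ_I δ_J`. -/
def weylSpan : Submodule K (Module.End K (QSpace Q)) :=
  Submodule.span K {φ | ∃ I J : Fin n → ℕ, φ = rhoPow Q I * deltaPow Q J}

theorem rhoX_mul_mem_weylSpan {φ : Module.End K (QSpace Q)} (hφ : φ ∈ weylSpan Q) (i : Fin n) :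
    rhoX Q i * φ ∈ weylSpan Q := by
  have : weylSpan Q ≤ (weylSpan Q).comap (LinearMap.mulLeft K (rhoX Q i)) := by
    refine Submodule.span_le.mpr ?_
    rintro _ ⟨I, J, rfl⟩
    rw [SetLike.mem_coe, Submodule.mem_comap, LinearMap.mulLeft_apply, ← mul_assoc,
      rhoX_mul_rhoPow, smul_mul_assoc]
    exact Submodule.smul_mem _ _ (Submodule.subset_span ⟨_, J, rfl⟩)
  exact this hφ

theorem delta_mul_mem_weylSpan {φ : Module.End K (QSpace Q)} (hφ : φ ∈ weylSpan Q) (i : Fin n) :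
    delta Q i * φ ∈ weylSpan Q := by
  have : weylSpan Q ≤ (weylSpan Q).comap (LinearMap.mulLeft K (delta Q i)) := by
    refine Submodule.span_le.mpr ?_
    rintro _ ⟨I, J, rfl⟩
    rw [SetLike.mem_coe, Submodule.mem_comap, LinearMap.mulLeft_apply]
    induction I using pi_nat_induction with
    | h0 =>
      obtain ⟨k, hk⟩ := exists_deltaPow_add_single Q i J
      have h : delta Q i * deltaPow Q J = ((k⁻¹ : Kˣ) : K) • deltaPow Q (J + Pi.single i 1) := by
        rw [hk, smul_smul, Units.inv_mul, one_smul]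
      rw [rhoPow_zero, one_mul, h]
      exact Submodule.smul_mem _ _ (Submodule.subset_span ⟨0, _, by rw [rhoPow_zero, one_mul]⟩)
    | h1 I j ih =>
      rw [rhoPow_add_single, smul_mul_assoc, mul_smul_comm, ← mul_assoc, ← mul_assoc,
        delta_mul_rhoX, add_mul, add_mul, smul_mul_assoc, smul_mul_assoc]
      refine Submodule.smul_mem _ _ (add_mem (Submodule.smul_mem _ _ ?_) ?_)
      · rw [mul_assoc, mul_assoc]
        exact rhoX_mul_mem_weylSpan Q ih j
      · split_ifs
        · rw [one_mul]; exact Submodule.subset_span ⟨I, J, rfl⟩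
        · rw [zero_mul, zero_mul]; exact zero_mem _
  exact this hφ

/-- The span contains `1` and is stable under left multiplication by all generators, by the relation
between `δ_i` and `ρ_{x_j}`. -/
theorem Delta_le_weylSpan {φ : Module.End K (QSpace Q)} (hφ : φ ∈ Delta Q) : φ ∈ weylSpan Q := by
  have key : ∀ ψ ∈ weylSpan Q, φ * ψ ∈ weylSpan Q := by
    refine Algebra.adjoin_induction
      (p := fun φ _ => ∀ ψ ∈ weylSpan Q, φ * ψ ∈ weylSpan Q) ?_ ?_ ?_ ?_ hφ
    · rintro _ (⟨i, rfl⟩ | ⟨i, rfl⟩) ψ hψ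
      · exact rhoX_mul_mem_weylSpan Q hψ i
      · exact delta_mul_mem_weylSpan Q hψ i
    · intro c ψ hψ
      rw [← Algebra.smul_def]
      exact Submodule.smul_mem _ _ hψ
    · intro x y _ _ hx hy ψ hψ
      rw [add_mul]; exact add_mem (hx ψ hψ) (hy ψ hψ)
    · intro x y _ _ hx hy ψ hψ
      rw [mul_assoc]; exact hx _ (hy ψ hψ)
  simpa using key 1 (Submodule.subset_span ⟨0, 0, by simp [rhoPow_zero, deltaPow_zero]⟩)

/-- In each degree an element of `Δ` has a polynomial coefficient function, and `σ_γ` only attaches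
the character `β(γ, ·)`; the same polynomial `g` serves for all `γ`. -/
theorem exists_coeffs_mul_sig [CharZero K] {φ : Module.End K (QSpace Q)} (hφ : φ ∈ Delta Q)
    (z : Fin n → ℤ) : ∃ g : (Fin n → ℕ) →₀ K, ∀ γ,
      coeffs Q (φ * sig Q γ) z = betaEval Q (Finsupp.single γ g) := by
  refine Submodule.span_induction (p := fun φ _ => ∃ g : (Fin n → ℕ) →₀ K, ∀ γ,
      coeffs Q (φ * sig Q γ) z = betaEval Q (Finsupp.single γ g)) ?_ ?_ ?_ ?_
      (Delta_le_weylSpan Q hφ)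
  · rintro _ ⟨I, J, rfl⟩
    obtain ⟨c, -, hc⟩ := exists_coeffs_gen Q I J
    by_cases hz : z = natVec I - natVec J
    · subst hz
      exact ⟨Finsupp.single J c, fun γ => by rw [hc, Pi.single_eq_same]⟩
    · exact ⟨0, fun γ => by rw [hc, Pi.single_eq_of_ne hz, Finsupp.single_zero, map_zero]⟩
  · exact ⟨0, fun γ => by rw [zero_mul, map_zero, Finsupp.single_zero, map_zero]; rfl⟩
  · rintro x y _ _ ⟨g, hg⟩ ⟨g', hg'⟩
    exact ⟨g + g', fun γ => by
      rw [add_mul, map_add, Pi.add_apply, hg, hg', Finsupp.single_add, map_add]⟩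
  · rintro c x _ ⟨g, hg⟩
    exact ⟨c • g, fun γ => by
      rw [smul_mul_assoc, map_smul, Pi.smul_apply, hg, ← Finsupp.smul_single, map_smul]⟩

theorem Delta_le_Dq : Delta Q ≤ Dq (grading Q) (natBichar Q) := by
  refine Algebra.adjoin_le ?_
  rintro _ (⟨i, rfl⟩ | ⟨i, rfl⟩)
  · exact Set.mem_iUnion.mpr ⟨0, rhoX_mem_DqOrder Q i⟩
  · exact Set.mem_iUnion.mpr ⟨1, delta_mem_DqOrder Q i⟩

/-- The homomorphism `γ ↦ σ_γ` into `D_q(R)`. -/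
def sigHom : Multiplicative (Fin n → ℤ) →* Dq (grading Q) (natBichar Q) where
  toFun g := ⟨sig Q g.toAdd, Set.mem_iUnion.mpr ⟨0, sig_mem_DqOrder Q _⟩⟩
  map_one' := Subtype.ext (sigma_zero _ _)
  map_mul' g h := Subtype.ext (sigma_mul _ _ g.toAdd h.toAdd).symm

/-- The homomorphism `Δ # ℤ^n → D_q(R)`, `φ γ ↦ φ σ_γ`. -/
def skewToDq : SkewDelta Q →ₐ[K] Dq (grading Q) (natBichar Q) :=
  SkewMonoidAlgebra.liftNCAlgHom (Subalgebra.inclusion (Delta_le_Dq Q)) (sigHom Q) (by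
    intro φ g
    refine Subtype.ext ?_
    change sig Q g.toAdd * φ.1 * sig Q (-g.toAdd) * sig Q g.toAdd = sig Q g.toAdd * φ.1
    rw [mul_assoc, sig, sig, sigma_neg_mul_sigma, mul_one])

theorem skewToDq_single (g : Multiplicative (Fin n → ℤ)) (φ : Delta Q) :
    (skewToDq Q (SkewMonoidAlgebra.single g φ) : Module.End K (QSpace Q)) =
      φ * sig Q g.toAdd :=
  congrArg Subtype.val (SkewMonoidAlgebra.liftNC_single _ _ g φ)

theorem skewToDq_apply (u : SkewDelta Q) {s : Finset (Multiplicative (Fin n → ℤ))}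
    (hs : u.support ⊆ s) :
    (skewToDq Q u : Module.End K (QSpace Q)) =
      ∑ g ∈ s, (u.coeff g : Module.End K (QSpace Q)) * sig Q g.toAdd := by
  conv_lhs => rw [← u.sum_single]
  rw [SkewMonoidAlgebra.sum_def', map_sum, AddSubmonoidClass.coe_finsetSum]
  refine (Finset.sum_congr rfl fun g _ => skewToDq_single Q g _).trans
    (Finset.sum_subset hs fun g _ hg => ?_)
  rw [SkewMonoidAlgebra.notMem_support_iff.mp hg, ZeroMemClass.coe_zero, zero_mul]

theorem skewToDq_mem_opFil {m : ℕ} {u : SkewDelta Q} (hu : u ∈ SkewDeltaFil Q m) :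
    (skewToDq Q u : Module.End K (QSpace Q)) ∈ opFil Q (m + 1) := by
  rw [skewToDq_apply Q u subset_rfl]
  refine Submodule.sum_mem _ fun g _ => ?_
  have : Submodule.span K {φ | ∃ I J : Fin n → ℕ, ∑ i, J i ≤ m ∧
      φ = rhoPow Q I * deltaPow Q J} ≤
      (opFil Q (m + 1)).comap (LinearMap.mulRight K (sig Q g.toAdd)) := by
    refine Submodule.span_le.mpr ?_
    rintro _ ⟨I, J, hJ, rfl⟩
    exact Submodule.subset_span ⟨I, J, g.toAdd, by omega, rfl⟩
  exact this (hu g)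

theorem exists_skewToDq_eq {m : ℕ} {φ : Module.End K (QSpace Q)} (hφ : φ ∈ opFil Q (m + 1)) :
    ∃ u ∈ SkewDeltaFil Q m, (skewToDq Q u : Module.End K (QSpace Q)) = φ := by
  have : opFil Q (m + 1) ≤ (SkewDeltaFil Q m).map
      ((Dq (grading Q) (natBichar Q)).val.toLinearMap ∘ₗ (skewToDq Q).toLinearMap) := by
    refine Submodule.span_le.mpr ?_
    rintro _ ⟨I, J, γ, hJ, rfl⟩
    refine ⟨SkewMonoidAlgebra.single (Multiplicative.ofAdd γ)
      ⟨rhoPow Q I * deltaPow Q J, mul_mem (rhoPow_mem Q I) (deltaPow_mem Q J)⟩, fun g => ?_,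
      skewToDq_single Q _ _⟩
    rw [SkewMonoidAlgebra.coeff_single, Finsupp.single_apply]
    split_ifs
    · exact Submodule.subset_span ⟨I, J, by omega, rfl⟩
    · exact zero_mem _
  exact this hφ

theorem skewToDq_injective [CharZero K] (i : Fin n)
    (hχ : Function.Injective fun γ (j : {j // j ≠ i}) => betaChar Q γ j.1) :
    Function.Injective (skewToDq Q) := by
  classical
  intro u v huv
  set s := u.support ∪ v.support with hs
  have hu := skewToDq_apply Q u (s := s) Finset.subset_union_left
  rw [huv, skewToDq_apply Q v (s := s) Finset.subset_union_right, ← sub_eq_zero,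
    ← Finset.sum_sub_distrib] at hu
  refine SkewMonoidAlgebra.ext fun g => ?_
  by_cases hg : g ∈ s
  swap
  · rw [hs, Finset.mem_union, not_or] at hg
    rw [SkewMonoidAlgebra.notMem_support_iff.mp hg.1, SkewMonoidAlgebra.notMem_support_iff.mp hg.2]
  refine Subtype.ext ((sub_eq_zero.mp (coeffs_injective Q ?_)).symm)
  rw [map_zero]
  ext1 z
  choose p hp using fun g => exists_coeffs_mul_sig Q (sub_mem (v.coeff g).2 (u.coeff g).2) z
  have h0 : betaEval Q (∑ g ∈ s, Finsupp.single g.toAdd (p g)) = 0 := by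
    rw [map_sum]
    have := congrFun (congrArg (coeffs Q) hu) z
    rw [map_sum, Finset.sum_apply, map_zero] at this
    rw [← Finset.sum_congr rfl fun g _ => hp g g.toAdd]
    simp only [sub_mul]
    exact this
  have h1 := DFunLike.congr_fun (quasiEval_injective (betaChar Q) i hχ _ h0) g.toAdd
  rw [Finsupp.finsetSum_apply, Finset.sum_eq_single g (fun g' _ hne => by
    rw [Finsupp.single_apply, if_neg fun h => hne (Multiplicative.toAdd.injective h)])
    (fun h => absurd hg h), Finsupp.single_eq_same] at h1
  -- The polynomial `p g` is zero and does not depend on `γ`; taking `γ = 0`, where `σ_0 = 1`, shows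
  -- that the coefficient of `v - u` at `g` itself vanishes.
  have h2 := hp g 0
  rw [sig, sigma_zero, mul_one, h1, Finsupp.zero_apply, Finsupp.single_zero, map_zero] at h2
  exact h2

end Skew

end QDiff

end

/-! ### Assembling the isomorphism of filtered algebras. -/

theorem mainTheorem3 {K : Type*} [Field K] [CharZero K] {n : ℕ} (hn : 3 ≤ n)
    (Q : QDiff.QMatrix K n)
    (hQ : AlgebraicIndependent ℚ
      (fun p : {p : Fin n × Fin n // p.1 < p.2} => ((Q.q p.1.1 p.1.2 : Kˣ) : K))) :
    ∃ f : QDiff.SkewDelta Q ≃ₐ[K] QDiff.Dq (QDiff.grading Q) (QDiff.natBichar Q),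
      (∀ (φ : QDiff.Delta Q) (γ : Fin n → ℤ),
        (f (SkewMonoidAlgebra.single (Multiplicative.ofAdd γ) φ) :
          Module.End K (QDiff.QSpace Q)) =
          (φ : Module.End K (QDiff.QSpace Q)) *
            QDiff.sigma (QDiff.grading Q) (QDiff.natBichar Q) γ) ∧
      ∀ (m : ℕ) (u : QDiff.SkewDelta Q),
        u ∈ QDiff.SkewDeltaFil Q m ↔
          (f u : Module.End K (QDiff.QSpace Q)) ∈
            QDiff.DqOrder (QDiff.grading Q) (QDiff.natBichar Q) m := by
  have hχ := QDiff.betaChar_injective hn hQ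
  -- `opFil` and `DqBelow` are indexed by strict bounds so that index `0` is the zero space; order
  -- at most `m` therefore corresponds to `m + 1`.
  have hfil : ∀ m, QDiff.DqOrder (QDiff.grading Q) (QDiff.natBichar Q) m = QDiff.opFil Q (m + 1) :=
    fun m => QDiff.DqBelow_eq_opFil Q hχ (by omega) (m + 1)
  have hinj := QDiff.skewToDq_injective Q ⟨0, by omega⟩ (hχ _)
  have hsurj : Function.Surjective (QDiff.skewToDq Q) := by
    rintro ⟨φ, hφ⟩
    obtain ⟨m, hm⟩ := Set.mem_iUnion.mp hφ
    rw [SetLike.mem_coe, hfil] at hm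
    obtain ⟨u, -, hu⟩ := QDiff.exists_skewToDq_eq Q hm
    exact ⟨u, Subtype.ext hu⟩
  refine ⟨AlgEquiv.ofBijective (QDiff.skewToDq Q) ⟨hinj, hsurj⟩,
    fun φ γ => QDiff.skewToDq_single Q _ φ, fun m u => ?_⟩
  rw [hfil]
  -- For the converse, the image has some preimage in the right filtration step, and injectivity
  -- identifies it with `u`.
  refine ⟨QDiff.skewToDq_mem_opFil Q, fun h => ?_⟩
  obtain ⟨v, hv, hvu⟩ := QDiff.exists_skewToDq_eq Q h
  exact hinj (Subtype.ext hvu) ▸ hv
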